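/- For $n \ge 5$ let $\mathcal{P}_n$ be the combinatorial $3$-polyhedron with $2n+2$ faces: a top and a bottom $n$-gon, and $2n$ lateral pentagons forming two rings $U_i$ and $W_i$ ($i \in \mathbb{Z}/n$), where three faces meet at each vertex and the vertices are $\{\mathrm{top}, U_i, U_{i+1}\}$, $\{U_i, U_{i+1}, W_i\}$, $\{W_i, W_{i+1}, U_{i+1}\}$, $\{\mathrm{bottom}, W_i, W_{i+1}\}$ for $i \in \mathbb{Z}/n$. A Löbell polyhedron $L_n$ is a compact polyhedron with non-empty interior in hyperbolic $3$-space $\mathbb{H}^3$ which has the combinatorial type of $\mathcal{P}_n$ and all of whose dihedral angles equal $\pi/2$. Let $\delta_n$ be the hyperbolic distance between the top and bottom faces of $L_n$, that is, the infimum of the distances between a point of the one and a point of the other. Then: (1) for every $n \ge 5$ a Löbell polyhedron $L_n$ exists; (2) for every $n \ge 5$ and every Löbell polyhedron $L_n$, $$\cosh \delta_n = \frac{\cos(\pi/n)}{\cos(2\pi/n)};$$ (3) for every choice of Löbell polyhedra $L_n$, $n \ge 5$, one has $\delta_n \to 0$ as $n \to \infty$. -/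

import Mathlib

open Filter Topology

noncomputable section

namespace Loebell

/-- The standard quadratic space of signature `(3, 1)`. -/
abbrev Minkowski : Type := Fin 4 → ℝ

/-- The scalar product `-x₀y₀ + x₁y₁ + x₂y₂ + x₃y₃`. -/
def form (x y : Minkowski) : ℝ := -(x 0 * y 0) + x 1 * y 1 + x 2 * y 2 + x 3 * y 3

/-- Hyperbolic 3-space: the upper sheet of the hyperboloid `(x, x) = -1`. -/
def hyperbolicSpace : Set Minkowski := {x | form x x = -1 ∧ 0 < x 0}

/-- The hyperbolic distance `ρ`, determined on the upper sheet by `cosh ρ(x, y) = -(x, y)`. -/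
def hypDist (x y : Minkowski) : ℝ := Real.arcosh (-(form x y))

section Polyhedra

variable {ι : Type}

/-- The intersection of the half-spaces `(x, e i) ≤ 0` of hyperbolic 3-space. -/
def polyhedron (e : ι → Minkowski) : Set Minkowski :=
  {x | x ∈ hyperbolicSpace ∧ ∀ i, form x (e i) ≤ 0}

/-- The face of the polyhedron on the hyperplane `(x, e i) = 0`. -/
def face (e : ι → Minkowski) (i : ι) : Set Minkowski :=
  {x | x ∈ polyhedron e ∧ form x (e i) = 0}

/-- Two distinct faces are adjacent if they share an edge. As two faces on different planes meet
in the empty set, a vertex or an edge, this says that they share at least two points. -/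
def Adjacent (e : ι → Minkowski) (i j : ι) : Prop :=
  i ≠ j ∧ (face e i ∩ face e j).Nontrivial

/-- The dihedral angle between two adjacent faces with outward unit normals `e i` and `e j`,
that is, `π` minus the angle between the normals. -/
def dihedralAngle (e : ι → Minkowski) (i j : ι) : ℝ := Real.arccos (-(form (e i) (e j)))

/-- The vectors `e i` are the outward unit normals of a compact right-angled polyhedron with
non-empty interior. -/
structure IsCompactRightAngled (e : ι → Minkowski) : Prop where
  unit : ∀ i, form (e i) (e i) = 1
  compact : IsCompact (polyhedron e)
  interior_nonempty : ∃ x ∈ hyperbolicSpace, ∀ i, form x (e i) < 0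
  right_angled : ∀ i j, Adjacent e i j → dihedralAngle e i j = Real.pi / 2

/-- The distance between two faces, `inf {ρ(x, y) | x ∈ face e i, y ∈ face e j}`. -/
def faceDist (e : ι → Minkowski) (i j : ι) : ℝ :=
  sInf {r : ℝ | ∃ x ∈ face e i, ∃ y ∈ face e j, r = hypDist x y}

end Polyhedra

/-- The `2n + 2` faces of the combinatorial Löbell polyhedron: the top and bottom `n`-gons and the
two rings of `n` lateral pentagons, `upper i` next to the top and `lower i` next to the bottom,
indexed cyclically. -/
inductive LFace (n : ℕ) : Type
  | top : LFace n
  | bottom : LFace n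
  | upper (i : ZMod n) : LFace n
  | lower (i : ZMod n) : LFace n

/-- The `4n` vertices of the combinatorial Löbell polyhedron, each given as the set of the three
faces that meet there. The face `upper i` has the neighbours `top`, `upper (i + 1)`, `lower i`,
`lower (i - 1)`, `upper (i - 1)`, and `lower i` has the neighbours `bottom`, `lower (i + 1)`,
`upper (i + 1)`, `upper i`, `lower (i - 1)`. -/
def vertices (n : ℕ) : Set (Set (LFace n)) :=
  {v | ∃ i : ZMod n,
    v = {LFace.top, LFace.upper i, LFace.upper (i + 1)} ∨
    v = {LFace.upper i, LFace.upper (i + 1), LFace.lower i} ∨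
    v = {LFace.lower i, LFace.lower (i + 1), LFace.upper (i + 1)} ∨
    v = {LFace.bottom, LFace.lower i, LFace.lower (i + 1)}}

/-- The polyhedron with normals `e` has the combinatorial type of the Löbell polyhedron, by the
given labelling of its faces: a set of faces has a common point if and only if these faces meet at
a common vertex of the combinatorial polyhedron. For a compact polyhedron this means that
every `face e f` is a two-dimensional face and that the vertex-face incidences, hence the face
lattice, are the prescribed ones. -/
def HasLoebellType {n : ℕ} (e : LFace n → Minkowski) : Prop :=
  ∀ S : Set (LFace n),
    (∃ x ∈ polyhedron e, ∀ f ∈ S, x ∈ face e f) ↔ ∃ v ∈ vertices n, S ⊆ v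

/-- The vectors `e f` are the outward unit normals of a (labelled) Löbell polyhedron `L_n`: a
compact right-angled polyhedron in hyperbolic 3-space of the Löbell combinatorial type. -/
structure IsLoebell (n : ℕ) (e : LFace n → Minkowski) : Prop where
  rightAngled : IsCompactRightAngled e
  combinatorialType : HasLoebellType e

/-- The distance `δ` between the top and the bottom face. -/
def topBottomDist {n : ℕ} (e : LFace n → Minkowski) : ℝ := faceDist e LFace.top LFace.bottom

end Loebell

end

/-!
The rigidity of the Löbell polyhedra comes from a conserved quantity. List the lateral faces in the
cyclic order `U₀, W₀, U₁, W₁, …` and call their normals `F k`, with `k` an integer modulo `2n`.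
Faces whose indices differ by `1` or `2` are adjacent, so `F k`, `F (k + 1)`, `F (k + 2)` together
with the vertex `A k` on these three faces form a Lorentz-orthonormal basis, and Parseval's identity
(`form_eq_of_orthonormal`) expresses everything else in it. In particular
`F (k + 3) = -cosh z • F k + sinh z • A k`, where `z = z k` is the length of the zigzag edge from
`A k` to `A (k + 1)`. Writing `S k = sinh² (z k)`, the right-angled lateral pentagons give two
relations that link `S k`, `S (k + 1)` and the edges between neighbours in the same ring
(`IsBand.pentagon_right`, `IsBand.pentagon_left`). Eliminating those edges shows that
`S k * r (k - 1) * r (k + 1)`, with `r = S / (1 + S)`, is independent of `k`, and that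
`S k * S (k + 1) > 1`. Comparison of a maximum with a minimum of `S` then forces `S` to be constant
(`eq_of_pentagon_relations`), without any assumption of symmetry.

With constant `c = cosh z` the normals satisfy `F (k + 4) = c F (k + 3) - c F (k + 1) + F k`. The
products of the vertex `A 0` with the normals are, up to a negative factor, squares or products of
two consecutive terms of the solution of `x (m + 2) = c x (m + 1) - x m`, `x 0 = 0`, `x 1 = 1`. As
`A 0` lies strictly inside all other half-spaces, `n` is the first positive zero of `x`, and
comparison with `sin (m π / n)` gives `c = 2 cos (π / n)` (`IsBand.edgeCosh_eq_two_mul_cos`). The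
product of the normals of top and bottom follows (`IsBand.form_top_bottom`). It is minus the
hyperbolic cosine of the distance between the two planes, and the feet of their common
perpendicular lie in the faces, so the distance between the faces is attained there
(`cosh_faceDist`).

Existence is shown on a model with `n`-fold symmetry (`IsCoefficients`, `model`). Its `4n` vertices
are written down (`IsCoefficients.exists_vertex_model`), and the planes of any two non-adjacent
faces are ultraparallel, so that the faces through a point are pairwise adjacent and hence share a
vertex (`IsCoefficients.exists_vertex_of_mem_model`). The limit follows from the formula for
`cosh δ`.
-/

open Filter Topology

noncomputable section

namespace Loebell

/-! ### The Lorentzian scalar product -/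

theorem form_comm (x y : Minkowski) : form x y = form y x := by
  simp only [form]; ring

theorem form_add_left (x y z : Minkowski) : form (x + y) z = form x z + form y z := by
  simp only [form, Pi.add_apply]; ring

theorem form_smul_left (r : ℝ) (x y : Minkowski) : form (r • x) y = r * form x y := by
  simp only [form, Pi.smul_apply, smul_eq_mul]; ring

theorem form_add_right (x y z : Minkowski) : form x (y + z) = form x y + form x z := by
  simp only [form, Pi.add_apply]; ring

theorem form_smul_right (r : ℝ) (x y : Minkowski) : form x (r • y) = r * form x y := by
  simp only [form, Pi.smul_apply, smul_eq_mul]; ring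

/-- Parseval's identity for a Lorentz-orthonormal basis `a, b, c, d` with `d` timelike. -/
theorem form_eq_of_orthonormal {a b c d : Minkowski}
    (haa : form a a = 1) (hbb : form b b = 1) (hcc : form c c = 1) (hdd : form d d = -1)
    (hab : form a b = 0) (hac : form a c = 0) (had : form a d = 0)
    (hbc : form b c = 0) (hbd : form b d = 0) (hcd : form c d = 0) (x y : Minkowski) :
    form x y = form x a * form y a + form x b * form y b + form x c * form y c
      - form x d * form y d := by
  let X : Matrix (Fin 4) (Fin 4) ℝ := Matrix.of ![a, b, c, d]
  let Y : Matrix (Fin 4) (Fin 4) ℝ :=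
    Matrix.of fun p i => (![-1, 1, 1, 1] : Fin 4 → ℝ) p * (![1, 1, 1, -1] : Fin 4 → ℝ) i *
      (![a, b, c, d] : Fin 4 → Minkowski) i p
  have hba := form_comm b a ▸ hab
  have hca := form_comm c a ▸ hac
  have hda := form_comm d a ▸ had
  have hcb := form_comm c b ▸ hbc
  have hdb := form_comm d b ▸ hbd
  have hdc := form_comm d c ▸ hcd
  have hXY : X * Y = 1 := by
    simp only [form] at *
    ext i j
    fin_cases i <;> fin_cases j <;>
      simp [X, Y, Matrix.mul_apply, Fin.sum_univ_four] <;> linarith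
  have hYX : Y * X = 1 := mul_eq_one_comm.mp hXY
  have hx : x = form x a • a + form x b • b + form x c • c - form x d • d := by
    have e : ∀ q, x q = ∑ p, x p * (Y * X) p q := by
      intro q
      rw [hYX]
      simp [Matrix.one_apply]
    ext q
    rw [e q]
    simp [X, Y, Matrix.mul_apply, Fin.sum_univ_four, form]
    ring
  conv_lhs => rw [hx]
  simp only [sub_eq_add_neg, form_add_left, form_smul_left, ← neg_smul]
  rw [form_comm y a, form_comm y b, form_comm y c, form_comm y d]
  ring

/-- The orthogonal complement of a point of hyperbolic space is positive semidefinite. -/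
theorem form_self_add_sq_nonneg {x : Minkowski} (hx : form x x = -1) (v : Minkowski) :
    0 ≤ form v v + form x v ^ 2 := by
  -- `w` is the component of `v` orthogonal to `x`
  set w : Minkowski := v + form x v • x with hw
  have hxw : form x w = 0 := by
    rw [hw, form_add_right, form_smul_right, hx]; ring
  have hww : form w w = form v v + form x v ^ 2 := by
    rw [hw, form_add_right, form_smul_right, form_add_left, form_add_left, form_smul_left,
      form_smul_left, hx, form_comm v x]
    ring
  rw [← hww]
  clear_value w
  simp only [form] at hxw hx ⊢
  have h0 : 0 < x 0 ^ 2 := by nlinarith [sq_nonneg (x 1), sq_nonneg (x 2), sq_nonneg (x 3)]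
  have cs : (x 0 * w 0) ^ 2 ≤ (x 0 ^ 2 - 1) * (w 1 ^ 2 + w 2 ^ 2 + w 3 ^ 2) := by
    have e1 : x 0 * w 0 = x 1 * w 1 + x 2 * w 2 + x 3 * w 3 := by linarith
    have e2 : x 0 ^ 2 - 1 = x 1 ^ 2 + x 2 ^ 2 + x 3 ^ 2 := by linarith
    rw [e1, e2]
    nlinarith [sq_nonneg (x 1 * w 2 - x 2 * w 1), sq_nonneg (x 1 * w 3 - x 3 * w 1),
      sq_nonneg (x 2 * w 3 - x 3 * w 2)]
  have : 0 ≤ x 0 ^ 2 * (-(w 0 * w 0) + w 1 * w 1 + w 2 * w 2 + w 3 * w 3) := by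
    nlinarith [sq_nonneg (w 1), sq_nonneg (w 2), sq_nonneg (w 3)]
  exact nonneg_of_mul_nonneg_right this h0

/-- A causal vector in the upper half-space has negative product with a point of hyperbolic
space. -/
theorem form_neg_of_mem {x y : Minkowski} (hx : x ∈ hyperbolicSpace)
    (hy : form y y ≤ 0) (hy0 : 0 < y 0) : form x y < 0 := by
  obtain ⟨hx, hx0⟩ := hx
  simp only [form] at *
  have cs : (x 1 * y 1 + x 2 * y 2 + x 3 * y 3) ^ 2 < (x 0 * y 0) ^ 2 := by
    have h1 : (x 1 * y 1 + x 2 * y 2 + x 3 * y 3) ^ 2 ≤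
        (x 1 ^ 2 + x 2 ^ 2 + x 3 ^ 2) * (y 1 ^ 2 + y 2 ^ 2 + y 3 ^ 2) := by
      nlinarith [sq_nonneg (x 1 * y 2 - x 2 * y 1), sq_nonneg (x 1 * y 3 - x 3 * y 1),
        sq_nonneg (x 2 * y 3 - x 3 * y 2)]
    have h2 : (x 1 ^ 2 + x 2 ^ 2 + x 3 ^ 2) * (y 1 ^ 2 + y 2 ^ 2 + y 3 ^ 2) ≤
        (x 1 ^ 2 + x 2 ^ 2 + x 3 ^ 2) * y 0 ^ 2 :=
      mul_le_mul_of_nonneg_left (by linarith) (by positivity)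
    have h3 : (x 1 ^ 2 + x 2 ^ 2 + x 3 ^ 2) * y 0 ^ 2 < x 0 ^ 2 * y 0 ^ 2 :=
      mul_lt_mul_of_pos_right (by linarith) (by positivity)
    nlinarith
  have := (abs_lt_of_sq_lt_sq' cs (by positivity)).2
  linarith

theorem form_neg_of_mem_of_mem {x y : Minkowski} (hx : x ∈ hyperbolicSpace)
    (hy : y ∈ hyperbolicSpace) : form x y < 0 :=
  form_neg_of_mem hx (by rw [hy.1]; norm_num) hy.2

/-- Converse of `form_neg_of_mem_of_mem`: the sign of the product with a point of the upper sheet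
decides between the two sheets. -/
theorem mem_hyperbolicSpace_of_form_neg {x y : Minkowski} (hx : x ∈ hyperbolicSpace)
    (hy : form y y = -1) (hxy : form x y < 0) : y ∈ hyperbolicSpace := by
  refine ⟨hy, ?_⟩
  by_contra h0
  rcases (not_lt.mp h0).lt_or_eq with h0 | h0
  · have := form_neg_of_mem (y := (-1 : ℝ) • y) hx
      (by rw [form_smul_left, form_smul_right, hy]; norm_num) (by simpa using h0)
    rw [form_smul_right] at this
    linarith
  · simp only [form, h0] at hy
    nlinarith [sq_nonneg (y 1), sq_nonneg (y 2), sq_nonneg (y 3)]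

/-- A point of hyperbolic space cannot lie on two planes whose normals have product less
than `-1`. -/
theorem not_form_lt_neg_one {x u v : Minkowski} (hx : form x x = -1) (hu : form u u = 1)
    (hv : form v v = 1) (hxu : form x u = 0) (hxv : form x v = 0) : ¬ form u v < -1 := by
  intro h
  have := form_self_add_sq_nonneg hx (u + v)
  rw [form_add_right x, hxu, hxv, form_add_left, form_add_right, form_add_right, hu, hv,
    form_comm v u] at this
  nlinarith

/-- The distance between points of two ultraparallel planes with unit normals `u` and `v` is at
least the length of the common perpendicular. -/
theorem neg_form_le_neg_form {x y u v : Minkowski} (hx : x ∈ hyperbolicSpace)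
    (hy : y ∈ hyperbolicSpace) (hu : form u u = 1) (hv : form v v = 1)
    (hxu : form x u = 0) (hyv : form y v = 0) : -form u v ≤ -form x y := by
  have hxy := form_neg_of_mem_of_mem hx hy
  -- the component of `y` orthogonal to `u`
  have h1 := form_self_add_sq_nonneg hx.1 (y + (-form y u) • u)
  -- the component of `u` orthogonal to `v`
  have h2 := form_self_add_sq_nonneg hy.1 (u + (-form u v) • v)
  simp only [form_add_left, form_add_right, form_smul_left, form_smul_right, hxu, hyv, hu, hv,
    hy.1, form_comm u y, form_comm v u] at h1 h2
  refine (abs_le_of_sq_le_sq' ?_ (by linarith)).2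
  nlinarith

/-! ### The band of lateral faces -/

/-- The lateral faces in the cyclic order `U₀, W₀, U₁, W₁, …`, indexed by the integers with
period `2n`. Faces whose indices differ by `1` or `2` are adjacent. -/
def lateral (n : ℕ) (k : ℤ) : LFace n :=
  if k % 2 = 0 then LFace.upper ((k / 2 : ℤ) : ZMod n) else LFace.lower ((k / 2 : ℤ) : ZMod n)

/-- The `n`-gon adjacent to `lateral n k`: the top for even and the bottom for odd `k`. -/
def base (n : ℕ) (k : ℤ) : LFace n := if k % 2 = 0 then LFace.top else LFace.bottom

variable {n : ℕ}

theorem lateral_two_mul (i : ℤ) : lateral n (2 * i) = LFace.upper (i : ZMod n) := by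
  have h1 : (2 * i) % 2 = 0 := by omega
  have h2 : (2 * i) / 2 = i := by omega
  simp [lateral, h2]

theorem lateral_two_mul_add_one (i : ℤ) : lateral n (2 * i + 1) = LFace.lower (i : ZMod n) := by
  have h1 : ¬ (2 * i + 1) % 2 = 0 := by omega
  have h2 : (2 * i + 1) / 2 = i := by omega
  simp only [lateral, if_neg h1, h2]

theorem base_add_two (k : ℤ) : base n (k + 2) = base n k := by
  have : (k + 2) % 2 = k % 2 := by omega
  simp only [base, this]

theorem base_zero : base n 0 = LFace.top := by simp [base]

theorem base_one : base n 1 = LFace.bottom := by simp [base]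

theorem lateral_eq_iff {k l : ℤ} : lateral n k = lateral n l ↔ (2 * n : ℤ) ∣ k - l := by
  obtain ⟨i, rfl | rfl⟩ := Int.even_or_odd' k <;> obtain ⟨j, rfl | rfl⟩ := Int.even_or_odd' l
  · rw [lateral_two_mul, lateral_two_mul, LFace.upper.injEq, eq_comm,
      ZMod.intCast_eq_intCast_iff_dvd_sub, ← mul_sub, mul_dvd_mul_iff_left two_ne_zero]
  · rw [lateral_two_mul, lateral_two_mul_add_one]
    refine ⟨fun h => (by cases h), fun ⟨a, h⟩ => ?_⟩
    rw [mul_assoc] at h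
    omega
  · rw [lateral_two_mul, lateral_two_mul_add_one]
    refine ⟨fun h => (by cases h), fun ⟨a, h⟩ => ?_⟩
    rw [mul_assoc] at h
    omega
  · rw [lateral_two_mul_add_one, lateral_two_mul_add_one, LFace.lower.injEq, eq_comm,
      ZMod.intCast_eq_intCast_iff_dvd_sub, add_sub_add_right_eq_sub, ← mul_sub,
      mul_dvd_mul_iff_left two_ne_zero]

theorem base_ne_lateral (k l : ℤ) : base n k ≠ lateral n l := by
  unfold base lateral
  split_ifs <;> simp

theorem face_cases (f : LFace n) :
    f = LFace.top ∨ f = LFace.bottom ∨ ∃ k, f = lateral n k := by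
  rcases f with _ | _ | i | i
  · exact Or.inl rfl
  · exact Or.inr (Or.inl rfl)
  · exact Or.inr (Or.inr ⟨2 * (i.cast : ℤ), by rw [lateral_two_mul, ZMod.intCast_zmod_cast]⟩)
  · exact Or.inr (Or.inr ⟨2 * (i.cast : ℤ) + 1,
      by rw [lateral_two_mul_add_one, ZMod.intCast_zmod_cast]⟩)

theorem mem_vertices_iff {v : Set (LFace n)} : v ∈ vertices n ↔
    ∃ k : ℤ, v = {lateral n k, lateral n (k + 1), lateral n (k + 2)} ∨
      v = {base n k, lateral n k, lateral n (k + 2)} := by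
  have e2 (i : ℤ) : lateral n (2 * i + 2) = LFace.upper ((i : ZMod n) + 1) := by
    rw [show 2 * i + 2 = 2 * (i + 1) by ring, lateral_two_mul]; simp
  have e3 (i : ℤ) : lateral n (2 * i + 1 + 2) = LFace.lower ((i : ZMod n) + 1) := by
    rw [show 2 * i + 1 + 2 = 2 * (i + 1) + 1 by ring, lateral_two_mul_add_one]; simp
  have e4 (i : ℤ) : lateral n (2 * i + 1 + 1) = LFace.upper ((i : ZMod n) + 1) := by
    rw [show 2 * i + 1 + 1 = 2 * i + 2 by ring, e2]
  have b0 (i : ℤ) : base n (2 * i) = LFace.top := by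
    simp [base]
  have b1 (i : ℤ) : base n (2 * i + 1) = LFace.bottom := by
    have : ¬ (2 * i + 1) % 2 = 0 := by omega
    simp only [base, if_neg this]
  constructor
  · rintro ⟨i, h⟩
    obtain ⟨i, rfl⟩ := ZMod.intCast_surjective i
    rcases h with rfl | rfl | rfl | rfl
    · exact ⟨2 * i, Or.inr (by rw [b0, e2, lateral_two_mul])⟩
    · refine ⟨2 * i, Or.inl ?_⟩
      rw [e2, lateral_two_mul, lateral_two_mul_add_one, Set.pair_comm]
    · refine ⟨2 * i + 1, Or.inl ?_⟩
      rw [e3, e4, lateral_two_mul_add_one, Set.pair_comm]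
    · exact ⟨2 * i + 1, Or.inr (by rw [b1, e3, lateral_two_mul_add_one])⟩
  · rintro ⟨k, h⟩
    obtain ⟨i, rfl | rfl⟩ := Int.even_or_odd' k <;> refine ⟨i, ?_⟩ <;> rcases h with rfl | rfl
    · rw [e2, lateral_two_mul, lateral_two_mul_add_one, Set.pair_comm]; tauto
    · rw [b0, e2, lateral_two_mul]; tauto
    · rw [e3, e4, lateral_two_mul_add_one, Set.pair_comm]; tauto
    · rw [b1, e3, lateral_two_mul_add_one]; tauto

/-- No vertex lies on four faces. -/
theorem not_subset_vertex {v : Set (LFace n)} (hv : v ∈ vertices n) {a b c d : LFace n}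
    (hab : a ≠ b) (hac : a ≠ c) (had : a ≠ d) (hbc : b ≠ c) (hbd : b ≠ d) (hcd : c ≠ d)
    (h : ({a, b, c, d} : Set (LFace n)) ⊆ v) : False := by
  have key : ∀ p q r : LFace n, v = {p, q, r} → False := by
    rintro p q r rfl
    simp only [Set.insert_subset_iff, Set.singleton_subset_iff, Set.mem_insert_iff,
      Set.mem_singleton_iff] at h
    grind
  obtain ⟨k, h | h⟩ := mem_vertices_iff.mp hv <;> exact key _ _ _ h

/-! ### A periodic recurrence with only constant solutions -/

theorem int_eq_of_succ_eq {I : ℤ → ℝ} (h : ∀ k, I (k + 1) = I k) (k l : ℤ) : I k = I l := by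
  have h0 : ∀ k, I k = I 0 := fun k => by
    induction k using Int.induction_on with
    | zero => rfl
    | succ i hi => rw [h, hi]
    | pred i hi => rw [← hi, ← h (-(i : ℤ) - 1)]; congr 1; ring
  rw [h0, h0 l]

theorem exists_forall_le_of_periodic {S : ℤ → ℝ} {m : ℕ} (hm : 0 < m)
    (hS : ∀ k, S (k + m) = S k) : ∃ M, ∀ k, S k ≤ S M := by
  have hper : Function.Periodic S (m : ℤ) := hS
  have hm' : (m : ℤ) ≠ 0 := by omega
  obtain ⟨M, -, hM⟩ := Finset.exists_max_image (Finset.Ico (0 : ℤ) m) S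
    ⟨0, by simp [hm]⟩
  refine ⟨M, fun k => ?_⟩
  have : S k = S (k % m) := by
    conv_lhs => rw [← Int.emod_add_mul_ediv k m, mul_comm]
    exact hper.int_mul _ _
  rw [this]
  exact hM _ (Finset.mem_Ico.mpr ⟨Int.emod_nonneg _ hm', Int.emod_lt_of_pos _ (by omega)⟩)

/-- The squares `S` of the hyperbolic sines of the lengths of the zigzag edges are constant.
The quantity `S k * r (k - 1) * r (k + 1)` with `r = S / (1 + S)` does not depend on `k`;
comparing it at a maximum and at a minimum of `S`, whose product exceeds `1`, shows that the two
agree. -/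
theorem eq_of_pentagon_relations {S a : ℤ → ℝ} {m : ℕ} (hm : 0 < m)
    (hS : ∀ k, S (k + m) = S k) (hpos : ∀ k, 0 < S k) (ha : ∀ k, 0 < a k)
    (h1 : ∀ k, 1 + a (k + 2) = S k * a k) (h2 : ∀ k, 1 + a k = S (k + 1) * a (k + 2)) (k l : ℤ) :
    S k = S l := by
  -- Elimination of `a (k + 2)` between the two relations.
  have hprod : ∀ k, 1 < S k * S (k + 1) := fun k => by
    have e : a k * (S k * S (k + 1) - 1) = 1 + S (k + 1) := by
      linear_combination -(1 : ℝ) * h2 k - S (k + 1) * h1 k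
    have := hpos (k + 1)
    have := pos_of_mul_pos_right (a := a k) (by rw [e]; linarith) (ha k).le
    linarith
  set r : ℤ → ℝ := fun k => S k / (1 + S k) with hr
  have hr' : ∀ k, r k * (1 + S k) = S k := fun k => by
    have := hpos k
    simp only [hr]
    field_simp
  -- Both sides are `(1 + a (k + 2)) / a (k + 2)`.
  have key : ∀ k, r (k + 2 + 1) * (1 + S (k + 2)) = r k * (1 + S (k + 1)) := fun k => by
    have e1 : r (k + 2 + 1) * (1 + S (k + 2)) * a (k + 2) = 1 + a (k + 2) := by
      have := hpos (k + 2 + 1)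
      simp only [hr]
      field_simp
      linear_combination -(1 : ℝ) * h2 (k + 2) - S (k + 2 + 1) * h1 (k + 2)
    have e2 : r k * (1 + S (k + 1)) * a (k + 2) = 1 + a (k + 2) := by
      have := hpos k
      simp only [hr]
      field_simp
      linear_combination -(1 : ℝ) * h1 k - S k * h2 k
    exact mul_right_cancel₀ (ha (k + 2)).ne' (e1.trans e2.symm)
  have hI : ∀ k l, S (k + 1) * r k * r (k + 1 + 1) = S (l + 1) * r l * r (l + 1 + 1) :=
    int_eq_of_succ_eq (I := fun k => S (k + 1) * r k * r (k + 1 + 1)) fun k => by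
      have e1 := hr' (k + 1)
      have e2 := hr' (k + 2)
      have e3 := key k
      simp only [show k + 1 + 1 = k + 2 by ring] at *
      linear_combination r (k + 1) * r (k + 2) * e3 + r k * r (k + 2) * e1 -
        r (k + 1) * r (k + 2 + 1) * e2
  obtain ⟨M, hM⟩ := exists_forall_le_of_periodic hm hS
  obtain ⟨μ, hμ⟩ := exists_forall_le_of_periodic (S := fun k => -S k) hm (fun k => by rw [hS])
  have hμ : ∀ k, S μ ≤ S k := fun k => neg_le_neg_iff.mp (hμ k)
  have hrmono : ∀ k l, S k ≤ S l → r k ≤ r l := fun k l h => by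
    have := hpos k
    have := hpos l
    simp only [hr]
    rw [div_le_div_iff₀ (by linarith) (by linarith)]
    linarith
  have hrpos : ∀ k, 0 < r k := fun k => div_pos (hpos k) (by linarith [hpos k])
  have hMμ : 1 < S M * S μ :=
    (hprod μ).trans_le (by rw [mul_comm]; exact mul_le_mul_of_nonneg_right (hM _) (hpos _).le)
  have hcomp : S M * r μ * r μ ≤ S μ * r M * r M := by
    have e := hI (M - 1) (μ - 1)
    rw [sub_add_cancel, sub_add_cancel] at e
    calc S M * r μ * r μ ≤ S M * r (M - 1) * r (M + 1) := by
          have := hrmono _ _ (hμ (M - 1))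
          have := hrmono _ _ (hμ (M + 1))
          have := hpos M
          have := hrpos μ
          have := hrpos (M - 1)
          gcongr
      _ = S μ * r (μ - 1) * r (μ + 1) := e
      _ ≤ S μ * r M * r M := by
          have := hrmono _ _ (hM (μ - 1))
          have := hrmono _ _ (hM (μ + 1))
          have := hpos μ
          have := hrpos M
          have := hrpos (μ + 1)
          gcongr
  have hle : S M ≤ S μ := by
    have p1 := hpos M
    have p2 := hpos μ
    have e : S M * (S μ * S μ) * ((1 + S M) * (1 + S M)) ≤
        S μ * (S M * S M) * ((1 + S μ) * (1 + S μ)) := by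
      have q := mul_le_mul_of_nonneg_right hcomp
        (by positivity : 0 ≤ ((1 + S M) * (1 + S M)) * ((1 + S μ) * (1 + S μ)))
      calc _ = S M * (r μ * (1 + S μ)) * (r μ * (1 + S μ)) * ((1 + S M) * (1 + S M)) := by
            rw [hr']; ring
        _ = S M * r μ * r μ * (((1 + S M) * (1 + S M)) * ((1 + S μ) * (1 + S μ))) := by ring
        _ ≤ _ := q
        _ = S μ * (r M * (1 + S M)) * (r M * (1 + S M)) * ((1 + S μ) * (1 + S μ)) := by ring
        _ = _ := by rw [hr']; ring
    have e' : S μ * S M * ((S M - S μ) * (S M * S μ - 1)) ≤ 0 := by linarith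
    by_contra hlt
    have := mul_pos (mul_pos p2 p1) (mul_pos (sub_pos.mpr (not_le.mp hlt)) (sub_pos.mpr hMμ))
    linarith
  exact le_antisymm ((hM k).trans (hle.trans (hμ l))) ((hM l).trans (hle.trans (hμ k)))

/-! ### Rigidity of the band -/

/-- The data carried by a Löbell polyhedron: the outward normals `F k` of the lateral faces in
cyclic order, the normals `N k` of the `n`-gons (of period two), and the vertices `A k` where the
faces `k`, `k + 1`, `k + 2` meet. -/
structure IsBand (n : ℕ) (F A N : ℤ → Minkowski) : Prop where
  five_le : 5 ≤ n
  F_F : ∀ k, form (F k) (F k) = 1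
  F_F_one : ∀ k, form (F k) (F (k + 1)) = 0
  F_F_two : ∀ k, form (F k) (F (k + 2)) = 0
  F_periodic : ∀ k, F (k + 2 * n) = F k
  N_N : ∀ k, form (N k) (N k) = 1
  N_F : ∀ k, form (N k) (F k) = 0
  N_periodic : ∀ k, N (k + 2) = N k
  A_mem : ∀ k, A k ∈ hyperbolicSpace
  A_F_zero : ∀ k, form (A k) (F k) = 0
  A_F_one : ∀ k, form (A k) (F (k + 1)) = 0
  A_F_two : ∀ k, form (A k) (F (k + 2)) = 0
  A_F_neg : ∀ k j : ℤ, ¬ (2 * n : ℤ) ∣ j - k → ¬ (2 * n : ℤ) ∣ j - (k + 1) →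
    ¬ (2 * n : ℤ) ∣ j - (k + 2) → form (A k) (F j) < 0
  A_N_neg : ∀ k j, form (A k) (N j) < 0

theorem not_dvd_of_pos_of_lt {m k : ℤ} (h0 : 0 < k) (h : k < m) : ¬ m ∣ k :=
  fun hd => absurd (Int.le_of_dvd h0 hd) (not_le.mpr h)

theorem not_dvd_of_neg_of_lt {m k : ℤ} (h0 : k < 0) (h : -m < k) : ¬ m ∣ k := fun hd =>
  not_dvd_of_pos_of_lt (m := m) (k := -k) (by omega) (by omega) ((dvd_neg).mpr hd)

namespace IsBand

variable {n : ℕ} {F A N : ℤ → Minkowski} (h : IsBand n F A N)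
include h

theorem parseval (k : ℤ) (x y : Minkowski) :
    form x y = form x (F k) * form y (F k) + form x (F (k + 1)) * form y (F (k + 1)) +
      form x (F (k + 2)) * form y (F (k + 2)) - form x (A k) * form y (A k) := by
  have e := h.F_F_one (k + 1)
  rw [show k + 1 + 1 = k + 2 by ring] at e
  refine form_eq_of_orthonormal (h.F_F _) (h.F_F _) (h.F_F _) (h.A_mem k).1 (h.F_F_one k)
    (h.F_F_two k) ?_ e ?_ ?_ x y
  · rw [form_comm, h.A_F_zero]
  · rw [form_comm, h.A_F_one]
  · rw [form_comm, h.A_F_two]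

end IsBand

/-- The hyperbolic cosine of the length of the edge between the lateral faces `k + 1` and
`k + 2`, which runs from the face `k` to the face `k + 3`. -/
def edgeCosh (F : ℤ → Minkowski) (k : ℤ) : ℝ := -form (F k) (F (k + 3))

/-- The hyperbolic sine of the length of the edge between the lateral faces `k + 1` and `k + 2`,
read off from the distance of its endpoint `A k` to the face `k + 3`. -/
def edgeSinh (F A : ℤ → Minkowski) (k : ℤ) : ℝ := -form (A k) (F (k + 3))

/-- Sturm comparison: a solution of `x (m + 2) = c * x (m + 1) - x m` with the same first positive
zero `n` as `m ↦ sin (m * π / n)` has the same coefficient. -/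
theorem eq_two_mul_cos_of_recurrence {c : ℝ} {x : ℕ → ℝ} {n : ℕ} (hn : 2 ≤ n) (h0 : x 0 = 0)
    (hx : ∀ m, x (m + 2) = c * x (m + 1) - x m) (hpos : ∀ m, 0 < m → m < n → 0 < x m)
    (hxn : x n = 0) : c = 2 * Real.cos (Real.pi / n) := by
  have hn0 : (0 : ℝ) < n := by positivity
  set α := Real.pi / n with hα
  have hnα : n * α = Real.pi := by rw [hα]; field_simp
  let y : ℕ → ℝ := fun m => Real.sin (m * α)
  have hy : ∀ m, y (m + 2) = 2 * Real.cos α * y (m + 1) - y m := fun m => by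
    have e1 : ((m + 2 : ℕ) : ℝ) * α = ((m + 1 : ℕ) : ℝ) * α + α := by push_cast; ring
    have e2 : (m : ℝ) * α = ((m + 1 : ℕ) : ℝ) * α - α := by push_cast; ring
    simp only [y]
    rw [e1, e2, Real.sin_add, Real.sin_sub]
    ring
  have hypos : ∀ m, 0 < m → m < n → 0 < y m := fun m hm hmn => by
    have hα0 : 0 < α := by positivity
    refine Real.sin_pos_of_pos_of_lt_pi (by positivity) ?_
    rw [← hnα]
    exact mul_lt_mul_of_pos_right (by exact_mod_cast hmn) hα0
  -- the Casoratian vanishes at both ends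
  have hsum : ∀ m, (c - 2 * Real.cos α) * ∑ i ∈ Finset.range m, x (i + 1) * y (i + 1) =
      x (m + 1) * y m - x m * y (m + 1) := fun m => by
    induction m with
    | zero => simp [h0, y]
    | succ m ih =>
      rw [Finset.sum_range_succ, mul_add, ih, hx, hy]
      ring
  have hy_n : y n = 0 := by simp only [y]; rw [hnα, Real.sin_pi]
  obtain ⟨m, rfl⟩ : ∃ m, n = m + 1 := ⟨n - 1, by omega⟩
  have hs := hsum m
  rw [hxn, hy_n] at hs
  have hpos' : 0 < ∑ i ∈ Finset.range m, x (i + 1) * y (i + 1) := by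
    refine Finset.sum_pos (fun i hi => ?_) ⟨0, by simp; omega⟩
    have := Finset.mem_range.mp hi
    exact mul_pos (hpos _ (by omega) (by omega)) (hypos _ (by omega) (by omega))
  have : (c - 2 * Real.cos α) * ∑ i ∈ Finset.range m, x (i + 1) * y (i + 1) = 0 := by
    rw [hs]; ring
  have := (mul_eq_zero.mp this).resolve_right hpos'.ne'
  linarith

namespace IsBand

variable {n : ℕ} {F A N : ℤ → Minkowski} (h : IsBand n F A N)
include h

theorem edgeSinh_pos (k : ℤ) : 0 < edgeSinh F A k := by
  have := h.five_le
  have := h.A_F_neg k (k + 3) (not_dvd_of_pos_of_lt (by omega) (by omega))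
    (not_dvd_of_pos_of_lt (by omega) (by omega)) (not_dvd_of_pos_of_lt (by omega) (by omega))
  simp only [edgeSinh]
  linarith

theorem form_F_add_three (k : ℤ) (x : Minkowski) :
    form x (F (k + 3)) = -edgeCosh F k * form x (F k) + edgeSinh F A k * form x (A k) := by
  have e1 := h.F_F_two (k + 1)
  have e2 := h.F_F_one (k + 2)
  rw [show k + 1 + 2 = k + 3 by ring, form_comm] at e1
  rw [show k + 2 + 1 = k + 3 by ring, form_comm] at e2
  rw [h.parseval k, e1, e2, edgeCosh, edgeSinh, form_comm (F (k + 3)) (F k),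
    form_comm (F (k + 3)) (A k)]
  ring

theorem edgeCosh_sq (k : ℤ) : edgeCosh F k ^ 2 = 1 + edgeSinh F A k ^ 2 := by
  have e := h.form_F_add_three k (F (k + 3))
  rw [h.F_F, form_comm _ (F k), form_comm _ (A k)] at e
  simp only [edgeCosh, edgeSinh] at *
  linear_combination -e

/-- Both endpoints of an edge are at the same distance from the face beyond the other one, and
`form (A (k + 1)) (A k)` is minus the hyperbolic cosine of its length. -/
theorem edgeCosh_pos_and (k : ℤ) : 0 < edgeCosh F k ∧
    form (A (k + 1)) (F k) = -edgeSinh F A k ∧ form (A (k + 1)) (A k) = -edgeCosh F k := by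
  have h5 := h.five_le
  have hs := h.edgeSinh_pos k
  have hc := h.edgeCosh_sq k
  have hp := h.A_F_neg (k + 1) k (not_dvd_of_neg_of_lt (by omega) (by omega))
    (not_dvd_of_neg_of_lt (by omega) (by omega)) (not_dvd_of_neg_of_lt (by omega) (by omega))
  have hq := form_neg_of_mem_of_mem (h.A_mem (k + 1)) (h.A_mem k)
  have e1 := h.form_F_add_three k (A (k + 1))
  have e0 := h.A_F_two (k + 1)
  rw [show k + 1 + 2 = k + 3 by ring] at e0
  rw [e0] at e1
  have e2 := h.parseval k (A (k + 1)) (A (k + 1))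
  have e3 := h.A_F_one (k + 1)
  rw [show k + 1 + 1 = k + 2 by ring] at e3
  rw [(h.A_mem _).1, h.A_F_zero (k + 1), e3] at e2
  generalize form (A (k + 1)) (F k) = p at *
  generalize form (A (k + 1)) (A k) = q at *
  generalize edgeSinh F A k = s at *
  generalize edgeCosh F k = c at *
  have hc0 : 0 < c := by
    have : 0 < c * p * p := by
      have : c * p = s * q := by linarith
      rw [this]
      exact mul_pos_of_neg_of_neg (mul_neg_of_pos_of_neg hs hq) hp
    rw [mul_assoc] at this
    exact pos_of_mul_pos_left this (mul_pos_of_neg_of_neg hp hp).le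
  have hps : p = -s := by
    have : p ^ 2 = s ^ 2 := by
      linear_combination (-(p ^ 2)) * hc + (s ^ 2) * e2 + (s * q + c * p) * e1
    rcases sq_eq_sq_iff_eq_or_eq_neg.mp this with e | e
    · linarith
    · exact e
  refine ⟨hc0, hps, ?_⟩
  rw [hps] at e1
  have : s * (q + c) = 0 := by linarith
  have := (mul_eq_zero.mp this).resolve_left hs.ne'
  linarith

theorem form_A_succ (k : ℤ) (x : Minkowski) :
    form x (A (k + 1)) = -edgeSinh F A k * form x (F k) + edgeCosh F k * form x (A k) := by
  obtain ⟨-, e1, e2⟩ := h.edgeCosh_pos_and k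
  have e3 := h.A_F_one (k + 1)
  rw [show k + 1 + 1 = k + 2 by ring] at e3
  rw [h.parseval k, e1, e2, h.A_F_zero, e3]
  ring

theorem form_F (k : ℤ) (x : Minkowski) :
    form x (F k) = -edgeCosh F k * form x (F (k + 3)) + edgeSinh F A k * form x (A (k + 1)) := by
  rw [h.form_A_succ, h.form_F_add_three]
  linear_combination (-form x (F k)) * h.edgeCosh_sq k

/-- `cosh² = 1 + sinh²` for the edge between the lateral faces `k` and `k + 2`: its endpoints are
`A k` and a vertex of the `n`-gon with normal `N k`. -/
theorem one_add_sq (k : ℤ) : 1 + form (N k) (A k) ^ 2 = form (N k) (F (k + 1)) ^ 2 := by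
  have e := h.parseval k (N k) (N k)
  have e2 := h.N_F (k + 2)
  rw [h.N_periodic] at e2
  rw [h.N_N, h.N_F, e2] at e
  linear_combination e

/-- In the pentagon `k + 2`, the edge from `A (k + 2)` to the `n`-gon is opposite to the edge from
`A k` to the `n`-gon and the edge from `A k` to `A (k + 1)`. -/
theorem pentagon_right (k : ℤ) :
    1 + form (N (k + 2)) (A (k + 2)) ^ 2 = edgeSinh F A k ^ 2 * form (N k) (A k) ^ 2 := by
  rw [h.one_add_sq, h.N_periodic, show k + 2 + 1 = k + 3 by ring, h.form_F_add_three, h.N_F]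
  ring

/-- The mirror image of `pentagon_right`: in the pentagon `k + 2`, the edge from `A k` to the
`n`-gon is opposite to the edges that meet in `A (k + 2)`. -/
theorem pentagon_left (k : ℤ) :
    1 + form (N k) (A k) ^ 2 = edgeSinh F A (k + 1) ^ 2 * form (N (k + 2)) (A (k + 2)) ^ 2 := by
  have e := h.form_F (k + 1) (N (k + 2 + 2))
  rw [show k + 1 + 3 = k + 2 + 2 by ring, show k + 1 + 1 = k + 2 by ring, h.N_F, h.N_periodic,
    h.N_periodic] at e
  rw [h.one_add_sq, e, h.N_periodic]
  ring

theorem edgeCosh_periodic (k : ℤ) : edgeCosh F (k + (2 * n : ℕ)) = edgeCosh F k := by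
  have e := h.F_periodic (k + 3)
  simp only [edgeCosh]
  push_cast
  rw [h.F_periodic, show k + 2 * (n : ℤ) + 3 = k + 3 + 2 * n by ring, e]

/-- All edges of the zigzag have the same length. -/
theorem edgeSinh_eq (k l : ℤ) : edgeSinh F A k = edgeSinh F A l := by
  have h5 := h.five_le
  have e := eq_of_pentagon_relations (S := fun k => edgeSinh F A k ^ 2)
    (a := fun k => form (N k) (A k) ^ 2) (m := 2 * n) (by omega)
    (fun k => by
      have e1 := h.edgeCosh_sq k
      have e2 := h.edgeCosh_sq (k + (2 * n : ℕ))
      rw [h.edgeCosh_periodic] at e2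
      linarith)
    (fun k => pow_pos (h.edgeSinh_pos k) 2)
    (fun k => sq_pos_iff.mpr (form_comm (A k) (N k) ▸ (h.A_N_neg k k).ne))
    h.pentagon_right h.pentagon_left k l
  exact (sq_eq_sq₀ (h.edgeSinh_pos k).le (h.edgeSinh_pos l).le).mp e

theorem edgeCosh_eq (k l : ℤ) : edgeCosh F k = edgeCosh F l := by
  refine (sq_eq_sq₀ (h.edgeCosh_pos_and k).1.le (h.edgeCosh_pos_and l).1.le).mp ?_
  rw [h.edgeCosh_sq, h.edgeCosh_sq, h.edgeSinh_eq]

theorem form_F_add_four (k : ℤ) (x : Minkowski) : form x (F (k + 4)) =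
    edgeCosh F 0 * form x (F (k + 3)) - edgeCosh F 0 * form x (F (k + 1)) + form x (F k) := by
  rw [show k + 4 = k + 1 + 3 by ring, h.form_F_add_three (k + 1), h.form_A_succ,
    h.form_F_add_three k, h.edgeCosh_eq (k + 1) 0, h.edgeCosh_eq k 0, h.edgeSinh_eq (k + 1) k]
  have := h.edgeCosh_sq k
  rw [h.edgeCosh_eq k 0] at this
  linear_combination form x (F k) * this

/-- The values `form (A 0) (F k)` are products of consecutive terms of a solution `x` of a
recurrence of order two; as they are negative off the vertex `A 0`, the first positive zero of
`x` is `n`. -/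
theorem edgeCosh_eq_two_mul_cos (k : ℤ) : edgeCosh F k = 2 * Real.cos (Real.pi / n) := by
  rw [h.edgeCosh_eq k 0]
  have h5 := h.five_le
  set c := edgeCosh F 0 with hc
  set s := edgeSinh F A 0 with hs
  have hs0 : 0 < s := h.edgeSinh_pos 0
  let p : ℕ → ℝ × ℝ := fun m => (fun q : ℝ × ℝ => (q.2, c * q.2 - q.1))^[m] (0, 1)
  let x : ℕ → ℝ := fun m => (p m).1
  have hp : ∀ m, p (m + 1) = ((p m).2, c * (p m).2 - (p m).1) := fun m =>
    Function.iterate_succ_apply' _ _ _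
  have hx : ∀ m, x (m + 2) = c * x (m + 1) - x m := fun m => by
    simp only [x, hp]
  have hx0 : x 0 = 0 := rfl
  have hx1 : x 1 = 1 := rfl
  set w : ℤ → ℝ := fun j => form (A 0) (F j) with hw
  have hrec : ∀ j, w (j + 4) = c * w (j + 3) - c * w (j + 1) + w j := fun j =>
    h.form_F_add_four j (A 0)
  have hw0 : w 0 = 0 := h.A_F_zero 0
  have hw1 : w 1 = 0 := h.A_F_one 0
  have hw2 : w 2 = 0 := h.A_F_two 0
  have hw3 : w 3 = -s := by simp only [hs, edgeSinh, neg_neg, hw, zero_add]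
  -- Four consecutive values, as the recurrence for `w` has order four.
  have hwx : ∀ m : ℕ, (w (2 * m + 1) = -s * x m ^ 2 ∧ w (2 * m + 2) = -s * (x m * x (m + 1))) ∧
      w (2 * m + 3) = -s * x (m + 1) ^ 2 ∧ w (2 * m + 4) = -s * (x (m + 1) * x (m + 2)) := by
    intro m
    induction m with
    | zero =>
      have := hrec 0
      simp only [zero_add] at this
      refine ⟨⟨?_, ?_⟩, ?_, ?_⟩
      · simp [hw1, hx0]
      · simp [hw2, hx0]
      · simp [hw3, hx1]
      · rw [hx]
        simp [this, hw3, hw1, hw0, hx0, hx1, mul_comm]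
    | succ m ih =>
      obtain ⟨⟨i1, i2⟩, i3, i4⟩ := ih
      have r1 := hrec (2 * m + 1)
      have r2 := hrec (2 * m + 2)
      push_cast
      rw [show 2 * (m : ℤ) + 1 + 4 = 2 * (m + 1) + 3 by ring,
        show 2 * (m : ℤ) + 1 + 3 = 2 * m + 4 by ring,
        show 2 * (m : ℤ) + 1 + 1 = 2 * m + 2 by ring] at r1
      rw [show 2 * (m : ℤ) + 2 + 4 = 2 * (m + 1) + 4 by ring,
        show 2 * (m : ℤ) + 2 + 3 = 2 * (m + 1) + 3 by ring,
        show 2 * (m : ℤ) + 2 + 1 = 2 * m + 3 by ring] at r2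
      rw [show 2 * ((m : ℤ) + 1) + 1 = 2 * m + 3 by ring,
        show 2 * ((m : ℤ) + 1) + 2 = 2 * m + 4 by ring]
      have x1 := hx m
      have x2 := hx (m + 1)
      have r1' : w (2 * (m + 1) + 3) = -s * x (m + 2) ^ 2 := by
        rw [r1, i4, i2, i1, x1]; ring
      refine ⟨⟨i3, i4⟩, r1', ?_⟩
      rw [r2, r1', i3, i2, x2, x1]; ring
  have hxn : x n = 0 := by
    have e1 := (hwx n).1.1
    have e2 := h.F_periodic 1
    have e3 : w (2 * n + 1) = w 1 := by
      simp only [hw]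
      rw [add_comm, e2]
    rw [e3, hw1] at e1
    have : x n ^ 2 = 0 := by
      have : s * x n ^ 2 = 0 := by linarith
      exact (mul_eq_zero.mp this).resolve_left hs0.ne'
    exact pow_eq_zero_iff two_ne_zero |>.mp this
  have hpos : ∀ m, m + 1 < n → 0 < x (m + 1) := fun m => by
    induction m with
    | zero => intro _; rw [zero_add, hx1]; exact one_pos
    | succ m ih =>
      intro hm
      have i := ih (by omega)
      have e := (hwx (m + 1)).1.2
      have hneg : w (2 * (m + 1 : ℕ) + 2) < 0 := by
        refine h.A_F_neg 0 _ ?_ ?_ ?_ <;>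
          exact not_dvd_of_pos_of_lt (by push_cast; omega) (by push_cast; omega)
      rw [e] at hneg
      have : 0 < s * (x (m + 1) * x (m + 1 + 1)) := by linarith
      exact pos_of_mul_pos_right (pos_of_mul_pos_right this hs0.le) i.le
  refine eq_two_mul_cos_of_recurrence (by omega) hx0 hx (fun m h1 h2 => ?_) hxn
  obtain ⟨m, rfl⟩ : ∃ j, m = j + 1 := ⟨m - 1, by omega⟩
  exact hpos m h2

/-- The two pentagon relations for constant edge length. -/
theorem sq_mul_edgeSinh_sq_sub_one (k : ℤ) :
    form (N k) (A k) ^ 2 * (edgeSinh F A 0 ^ 2 - 1) = 1 := by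
  have e1 := h.pentagon_right k
  have e2 := h.pentagon_left k
  rw [h.edgeSinh_eq k 0] at e1
  rw [h.edgeSinh_eq (k + 1) 0] at e2
  have : (1 + edgeSinh F A 0 ^ 2) *
      (form (N k) (A k) ^ 2 * (edgeSinh F A 0 ^ 2 - 1) - 1) = 0 := by
    linear_combination (-1 : ℝ) * e2 - edgeSinh F A 0 ^ 2 * e1
  have := (mul_eq_zero.mp this).resolve_left (by positivity)
  linarith

theorem form_N_F_succ (k : ℤ) :
    form (N k) (F (k + 1)) = edgeSinh F A 0 * form (N 0) (A 0) := by
  have hconst : ∀ k, form (N k) (A k) = form (N 0) (A 0) := fun k => by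
    have e := h.sq_mul_edgeSinh_sq_sub_one k
    have e0 := h.sq_mul_edgeSinh_sq_sub_one 0
    have n1 := h.A_N_neg k k
    have n2 := h.A_N_neg 0 0
    rw [form_comm] at n1 n2
    have hne : edgeSinh F A 0 ^ 2 - 1 ≠ 0 := fun hz => by rw [hz] at e; simp at e
    have e' : form (N k) (A k) ^ 2 = form (N 0) (A 0) ^ 2 :=
      mul_right_cancel₀ hne (e.trans e0.symm)
    rcases sq_eq_sq_iff_eq_or_eq_neg.mp e' with e | e <;> linarith
  have e := h.form_F_add_three (k - 2) (N (k - 2))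
  rw [h.N_F, hconst, h.edgeSinh_eq (k - 2) 0, ← h.N_periodic, sub_add_cancel,
    show k - 2 + 3 = k + 1 by ring] at e
  rw [e]
  ring

theorem form_N_succ_F (k : ℤ) :
    form (N (k + 1)) (F k) = edgeSinh F A 0 * form (N 0) (A 0) := by
  rw [← h.form_N_F_succ (k - 1), sub_add_cancel, ← h.N_periodic (k - 1)]
  congr 2
  ring

theorem form_N_F_nonpos (k j : ℤ) : form (N k) (F j) ≤ 0 := by
  have hneg : edgeSinh F A 0 * form (N 0) (A 0) ≤ 0 := by
    have := h.A_N_neg 0 0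
    rw [form_comm] at this
    exact mul_nonpos_of_nonneg_of_nonpos (h.edgeSinh_pos 0).le this.le
  have hN : ∀ j i, N (j + i * 2) = N j := fun j i =>
    (show Function.Periodic N 2 from h.N_periodic).int_mul i j
  obtain ⟨i, hi | hi⟩ := Int.even_or_odd' (k - j)
  · rw [show k = j + i * 2 by linarith, hN, h.N_F]
  · rw [show k = j + 1 + i * 2 by linarith, hN, h.form_N_succ_F]
    exact hneg

theorem form_N_N_neg : form (N 0) (N 1) < 0 := by
  have h1 := h.A_N_neg 0 0
  have h2 := h.A_N_neg 0 1
  rw [form_comm] at h1 h2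
  have e2 := h.N_F 2
  rw [show (2 : ℤ) = 0 + 2 by ring, h.N_periodic] at e2
  have e1 := h.N_F 1
  rw [h.parseval 0, h.N_F 0, e2, show (0 : ℤ) + 1 = 1 by ring, e1]
  have := mul_pos_of_neg_of_neg h1 h2
  linarith

theorem form_N_N_sq : form (N 0) (N 1) ^ 2 =
    (form (N 0) (A 0) ^ 2 * edgeCosh F 0) ^ 2 := by
  have e2 := h.N_F 2
  rw [show (2 : ℤ) = 0 + 2 by ring, h.N_periodic] at e2
  have e1 := h.N_F 1
  have e3 := h.parseval 0 (N 1) (N 1)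
  have e4 := h.form_N_F_succ 1
  have e5 := h.form_N_succ_F 0
  rw [show (1 : ℤ) + 1 = 0 + 2 by ring] at e4
  rw [show (0 : ℤ) + 1 = 1 by ring] at e3 e5
  rw [e1, e4, e5, h.N_N] at e3
  have e6 : form (N 0) (N 1) = -(form (N 0) (A 0) * form (N 1) (A 0)) := by
    rw [h.parseval 0, h.N_F 0, e2, show (0 : ℤ) + 1 = 1 by ring, e1]
    ring
  have e7 := h.sq_mul_edgeSinh_sq_sub_one 0
  have e8 := h.edgeCosh_sq 0
  rw [e6]
  generalize form (N 0) (A 0) = u at *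
  linear_combination u ^ 2 * e3 - u ^ 4 * e8 + u ^ 2 * e7

theorem form_top_bottom : form (N 0) (N 1) =
    -(Real.cos (Real.pi / n) / Real.cos (2 * Real.pi / n)) := by
  have e7 := h.sq_mul_edgeSinh_sq_sub_one 0
  have e8 := h.edgeCosh_sq 0
  have hc := h.edgeCosh_eq_two_mul_cos 0
  have hneg := h.form_N_N_neg
  have hcpos := (h.edgeCosh_pos_and 0).1
  have e : form (N 0) (N 1) = -(form (N 0) (A 0) ^ 2 * edgeCosh F 0) := by
    rcases sq_eq_sq_iff_eq_or_eq_neg.mp h.form_N_N_sq with e | e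
    · have : 0 ≤ form (N 0) (A 0) ^ 2 * edgeCosh F 0 := by positivity
      linarith
    · exact e
  have hcos : edgeSinh F A 0 ^ 2 - 1 = 2 * Real.cos (2 * Real.pi / n) := by
    rw [show 2 * Real.pi / n = 2 * (Real.pi / n) by ring, Real.cos_two_mul]
    rw [hc] at e8
    linear_combination -e8
  rw [hcos] at e7
  have hne : Real.cos (2 * Real.pi / n) ≠ 0 := fun hz => by rw [hz] at e7; simp at e7
  rw [e, hc, neg_inj, eq_div_iff hne]
  linear_combination Real.cos (Real.pi / n) * e7

end IsBand

/-! ### The band of a Löbell polyhedron -/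

namespace IsLoebell

variable {n : ℕ} {e : LFace n → Minkowski} (h : IsLoebell n e)
include h

/-- A vertex lies strictly inside the half-space of every face but its three. -/
theorem form_neg_of_notMem {x : Minkowski} {a b c d : LFace n}
    (hx : x ∈ polyhedron e) (ha : x ∈ face e a) (hb : x ∈ face e b) (hc : x ∈ face e c)
    (hab : a ≠ b) (hac : a ≠ c) (had : a ≠ d) (hbc : b ≠ c) (hbd : b ≠ d) (hcd : c ≠ d) :
    form x (e d) < 0 := by
  refine lt_of_le_of_ne (hx.2 d) fun h0 => ?_
  obtain ⟨v, hv, hsub⟩ := (h.combinatorialType {a, b, c, d}).mp ⟨x, hx, by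
    rintro f (rfl | rfl | rfl | rfl)
    exacts [ha, hb, hc, ⟨hx, h0⟩]⟩
  exact not_subset_vertex hv hab hac had hbc hbd hcd hsub

/-- Two faces `a`, `b` with two vertices in common, one on a third face `c` and the other on a
fourth face `d`, are orthogonal. -/
theorem form_eq_zero {x y : Minkowski} {a b c d : LFace n}
    (hxa : x ∈ face e a) (hxb : x ∈ face e b) (hxc : x ∈ face e c)
    (hya : y ∈ face e a) (hyb : y ∈ face e b) (hyd : y ∈ face e d)
    (hab : a ≠ b) (hac : a ≠ c) (had : a ≠ d) (hbc : b ≠ c) (hbd : b ≠ d) (hcd : c ≠ d) :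
    form (e a) (e b) = 0 := by
  have hxy : x ≠ y := by
    rintro rfl
    exact (h.form_neg_of_notMem hxa.1 hxa hxb hxc hab hac had hbc hbd hcd).ne hyd.2
  have := h.rightAngled.right_angled a b ⟨hab, x, ⟨hxa, hxb⟩, y, ⟨hya, hyb⟩, hxy⟩
  rw [dihedralAngle, Real.arccos_eq_pi_div_two] at this
  linarith

/-- The incidences of the combinatorial type provide the vertices and the strict inequalities, and
any two faces that share two vertices are orthogonal. -/
theorem exists_isBand (hn : 5 ≤ n) :
    ∃ A, IsBand n (fun k => e (lateral n k)) A (fun k => e (base n k)) := by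
  have hA : ∀ k : ℤ, ∃ x ∈ polyhedron e, x ∈ face e (lateral n k) ∧
      x ∈ face e (lateral n (k + 1)) ∧ x ∈ face e (lateral n (k + 2)) := fun k => by
    obtain ⟨x, hx, hf⟩ := (h.combinatorialType _).mpr
      ⟨_, mem_vertices_iff.mpr ⟨k, Or.inl rfl⟩, subset_rfl⟩
    exact ⟨x, hx, hf _ (by simp), hf _ (by simp), hf _ (by simp)⟩
  have hV : ∀ k : ℤ, ∃ x ∈ polyhedron e, x ∈ face e (base n k) ∧
      x ∈ face e (lateral n k) ∧ x ∈ face e (lateral n (k + 2)) := fun k => by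
    obtain ⟨x, hx, hf⟩ := (h.combinatorialType _).mpr
      ⟨_, mem_vertices_iff.mpr ⟨k, Or.inr rfl⟩, subset_rfl⟩
    exact ⟨x, hx, hf _ (by simp), hf _ (by simp), hf _ (by simp)⟩
  choose A hAP hA0 hA1 hA2 using hA
  choose V hVP hVN hV0 hV2 using hV
  have hlat : ∀ k l : ℤ, k < l → l < k + 2 * n → lateral n k ≠ lateral n l := fun k l h1 h2 hkl =>
    not_dvd_of_neg_of_lt (by omega) (by omega) (lateral_eq_iff.mp hkl)
  have hlb : ∀ k l, lateral n k ≠ base n l := fun k l => (base_ne_lateral l k).symm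
  refine ⟨A, hn, fun k => h.rightAngled.unit _, fun k => ?_, fun k => ?_, fun k => ?_,
    fun k => h.rightAngled.unit _, fun k => ?_, fun k => ?_, fun k => (hAP k).1,
    fun k => (hA0 k).2, fun k => (hA1 k).2, fun k => (hA2 k).2,
    fun k j h0 h1 h2 => ?_, fun k j => ?_⟩
  -- The edge between the faces `k` and `k + 1` runs from `A (k - 1)` to `A k`.
  · have m1 := hA1 (k - 1)
    have m2 := hA2 (k - 1)
    rw [show k - 1 + 1 = k by ring] at m1
    rw [show k - 1 + 2 = k + 1 by ring] at m2
    exact h.form_eq_zero m1 m2 (hA0 (k - 1)) (hA0 k) (hA1 k) (hA2 k)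
      (hlat _ _ (by omega) (by omega)) (hlat _ _ (by omega) (by omega)).symm
      (hlat _ _ (by omega) (by omega)) (hlat _ _ (by omega) (by omega)).symm
      (hlat _ _ (by omega) (by omega)) (hlat _ _ (by omega) (by omega))
  -- The edge between the faces `k` and `k + 2` runs from `A k` to `V k`.
  · exact h.form_eq_zero (hA0 k) (hA2 k) (hA1 k) (hV0 k) (hV2 k) (hVN k)
      (hlat _ _ (by omega) (by omega)) (hlat _ _ (by omega) (by omega)) (hlb _ _)
      (hlat _ _ (by omega) (by omega)).symm (hlb _ _) (hlb _ _)
  · exact congrArg e (lateral_eq_iff.mpr (by simp))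
  -- The edge between the face `k` and its `n`-gon runs from `V (k - 2)` to `V k`.
  · have m1 := hVN (k - 2)
    have m2 := hV2 (k - 2)
    rw [← base_add_two, show k - 2 + 2 = k by ring] at m1
    rw [show k - 2 + 2 = k by ring] at m2
    exact h.form_eq_zero m1 m2 (hV0 (k - 2)) (hVN k) (hV0 k) (hV2 k) (hlb _ _).symm (hlb _ _).symm
      (hlb _ _).symm (hlat _ _ (by omega) (by omega)).symm (hlat _ _ (by omega) (by omega))
      (hlat _ _ (by omega) (by omega))
  · simp only [base_add_two]
  · have hne : ∀ i, ¬ (2 * n : ℤ) ∣ j - i → lateral n i ≠ lateral n j := fun i hi hij =>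
      hi (lateral_eq_iff.mp hij.symm)
    exact h.form_neg_of_notMem (hAP k) (hA0 k) (hA1 k) (hA2 k) (hlat _ _ (by omega) (by omega))
      (hlat _ _ (by omega) (by omega)) (hne _ h0) (hlat _ _ (by omega) (by omega)) (hne _ h1)
      (hne _ h2)
  · exact h.form_neg_of_notMem (hAP k) (hA0 k) (hA1 k) (hA2 k) (hlat _ _ (by omega) (by omega))
      (hlat _ _ (by omega) (by omega)) (hlb _ _) (hlat _ _ (by omega) (by omega)) (hlb _ _)
      (hlb _ _)

end IsLoebell

/-! ### The distance between two ultraparallel faces -/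

/-- The foot of the common perpendicular of two faces on the plane of the face `i` lies in the
polyhedron, provided that no other normal has positive product with those of the two faces. -/
theorem foot_mem_face {ι : Type} {e : ι → Minkowski} {i j : ι} {C : ℝ} {p : Minkowski} (hC : 1 < C)
    (hi : form (e i) (e i) = 1) (hj : form (e j) (e j) = 1) (hij : form (e i) (e j) = -C)
    (hi' : ∀ f, f ≠ i → form (e i) (e f) ≤ 0) (hj' : ∀ f, f ≠ j → form (e j) (e f) ≤ 0)
    (hp : p ∈ hyperbolicSpace) (hpi : form p (e i) < 0) (hpj : form p (e j) < 0) :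
    (√(C ^ 2 - 1))⁻¹ • (e j + C • e i) ∈ face e i := by
  have hC2 : 0 < C ^ 2 - 1 := by nlinarith
  have hji : form (e j) (e i) = -C := by rw [form_comm, hij]
  have hl : 0 < (√(C ^ 2 - 1))⁻¹ := inv_pos.mpr (Real.sqrt_pos.mpr hC2)
  have hl2 : (√(C ^ 2 - 1))⁻¹ * ((√(C ^ 2 - 1))⁻¹ * (C ^ 2 - 1)) = 1 := by
    rw [← mul_assoc, ← mul_inv, Real.mul_self_sqrt hC2.le, inv_mul_cancel₀ hC2.ne']
  set l := (√(C ^ 2 - 1))⁻¹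
  have hzero : form (l • (e j + C • e i)) (e i) = 0 := by
    rw [form_smul_left, form_add_left, form_smul_left, hji, hi]; ring
  refine ⟨⟨mem_hyperbolicSpace_of_form_neg hp ?_ ?_, fun f => ?_⟩, hzero⟩
  · rw [form_smul_left, form_smul_right, form_add_left, form_add_right, form_add_right,
      form_smul_left, form_smul_right, form_smul_left, form_smul_right, hj, hji, hij, hi]
    linear_combination -hl2
  · rw [form_smul_right, form_add_right, form_smul_right]
    exact mul_neg_of_pos_of_neg hl (by nlinarith)
  · by_cases hfi : f = i
    · rw [hfi, hzero]
    · rw [form_smul_left, form_add_left, form_smul_left]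
      refine mul_nonpos_of_nonneg_of_nonpos hl.le ?_
      by_cases hfj : f = j
      · rw [hfj, hj, hij]; nlinarith
      · nlinarith [hi' f hfi, hj' f hfj]

theorem cosh_faceDist {ι : Type} {e : ι → Minkowski} {i j : ι} {C : ℝ} {p : Minkowski} (hC : 1 < C)
    (hi : form (e i) (e i) = 1) (hj : form (e j) (e j) = 1) (hij : form (e i) (e j) = -C)
    (hi' : ∀ f, f ≠ i → form (e i) (e f) ≤ 0) (hj' : ∀ f, f ≠ j → form (e j) (e f) ≤ 0)
    (hp : p ∈ hyperbolicSpace) (hpi : form p (e i) < 0) (hpj : form p (e j) < 0) :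
    Real.cosh (faceDist e i j) = C := by
  have hleast : IsLeast {r : ℝ | ∃ x ∈ face e i, ∃ y ∈ face e j, r = hypDist x y}
      (Real.arcosh C) := by
    have hC2 : 0 < C ^ 2 - 1 := by nlinarith
    have hji : form (e j) (e i) = -C := by rw [form_comm, hij]
    refine ⟨⟨_, foot_mem_face hC hi hj hij hi' hj' hp hpi hpj, _,
      foot_mem_face hC hj hi hji hj' hi' hp hpj hpi, ?_⟩, ?_⟩
    · have hl2 : (√(C ^ 2 - 1))⁻¹ * ((√(C ^ 2 - 1))⁻¹ * (C ^ 2 - 1)) = 1 := by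
        rw [← mul_assoc, ← mul_inv, Real.mul_self_sqrt hC2.le, inv_mul_cancel₀ hC2.ne']
      rw [hypDist, form_smul_left, form_smul_right, form_add_left, form_add_right, form_add_right,
        form_smul_left, form_smul_right, form_smul_left, form_smul_right, hj, hji, hij, hi]
      congr 1
      linear_combination -C * hl2
    · rintro _ ⟨x, hx, y, hy, rfl⟩
      have := neg_form_le_neg_form hx.1.1 hy.1.1 hi hj hx.2 hy.2
      rw [hij, neg_neg] at this
      exact (Real.arcosh_le_arcosh (by linarith) (by linarith)).mpr this
  rw [faceDist, hleast.csInf_eq, Real.cosh_arcosh hC.le]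

theorem cos_pi_div_div_cos_gt_one {n : ℕ} (hn : 5 ≤ n) :
    1 < Real.cos (Real.pi / n) / Real.cos (2 * Real.pi / n) := by
  have hn' : (5 : ℝ) ≤ n := by exact_mod_cast hn
  have hpi := Real.pi_pos
  have h0 : 0 < Real.pi / n := by positivity
  have h1 : 2 * Real.pi / n < Real.pi / 2 := by
    rw [div_lt_div_iff₀ (by linarith) (by norm_num)]; nlinarith
  have h2 : Real.pi / n < 2 * Real.pi / n := by
    rw [show 2 * Real.pi / n = 2 * (Real.pi / n) by ring]; linarith
  rw [one_lt_div (Real.cos_pos_of_mem_Ioo ⟨by linarith, h1⟩)]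
  exact Real.cos_lt_cos_of_nonneg_of_le_pi_div_two h0.le h1.le h2

theorem IsLoebell.cosh_topBottomDist {n : ℕ} (hn : 5 ≤ n) {e : LFace n → Minkowski}
    (h : IsLoebell n e) : Real.cosh (topBottomDist e) =
      Real.cos (Real.pi / n) / Real.cos (2 * Real.pi / n) := by
  obtain ⟨A, hA⟩ := h.exists_isBand hn
  have hC := cos_pi_div_div_cos_gt_one hn
  have htb := hA.form_top_bottom
  have hAt := hA.A_N_neg 0 0
  have hAb := hA.A_N_neg 0 1
  have hTF := hA.form_N_F_nonpos 0
  have hBF := hA.form_N_F_nonpos 1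
  simp only [base_zero, base_one] at htb hAt hAb hTF hBF
  refine cosh_faceDist hC (h.rightAngled.unit _) (h.rightAngled.unit _) htb (fun f hf => ?_)
    (fun f hf => ?_) (hA.A_mem 0) hAt hAb
  · rcases face_cases f with rfl | rfl | ⟨k, rfl⟩
    · exact absurd rfl hf
    · rw [htb]; linarith
    · exact hTF k
  · rcases face_cases f with rfl | rfl | ⟨k, rfl⟩
    · rw [form_comm, htb]; linarith
    · exact absurd rfl hf
    · exact hBF k

theorem tendsto_topBottomDist {L : (n : ℕ) → LFace n → Minkowski}
    (hL : ∀ n, 5 ≤ n → IsLoebell n (L n)) :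
    Tendsto (fun n => topBottomDist (L n)) atTop (𝓝 0) := by
  have hnonneg : ∀ n, 0 ≤ topBottomDist (L n) := fun n => by
    refine Real.sInf_nonneg ?_
    rintro _ ⟨x, hx, y, hy, rfl⟩
    -- `1 ≤ -form x y` for points of hyperbolic space
    have hxy := form_neg_of_mem_of_mem hx.1.1 hy.1.1
    have hsq := form_self_add_sq_nonneg hx.1.1.1 y
    rw [hy.1.1.1] at hsq
    exact Real.arcosh_nonneg (by nlinarith)
  have hcosh : Tendsto (fun n : ℕ => Real.cos (Real.pi / n) / Real.cos (2 * Real.pi / n)) atTop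
      (𝓝[Set.Ici 1] 1) := by
    refine tendsto_nhdsWithin_iff.mpr ⟨?_, ?_⟩
    · have h1 := Real.continuous_cos.continuousAt.tendsto.comp
        (tendsto_const_div_atTop_nhds_zero_nat Real.pi)
      have h2 := Real.continuous_cos.continuousAt.tendsto.comp
        (tendsto_const_div_atTop_nhds_zero_nat (2 * Real.pi))
      have : Tendsto (fun n : ℕ => Real.cos (Real.pi / n) / Real.cos (2 * Real.pi / n)) atTop
          (𝓝 (Real.cos 0 / Real.cos 0)) := h1.div h2 (by simp)
      simpa using this
    · filter_upwards [eventually_ge_atTop 5] with n hn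
      exact (cos_pi_div_div_cos_gt_one hn).le
  have harcosh := (Real.continuousOn_arcosh 1 (by simp)).tendsto.comp hcosh
  rw [Real.arcosh_zero] at harcosh
  refine harcosh.congr' ?_
  filter_upwards [eventually_ge_atTop 5] with n hn
  rw [Function.comp_apply, ← (hL n hn).cosh_topBottomDist hn, Real.arcosh_cosh (hnonneg n)]

/-! ### The symmetric model -/

/-- The sign `(-1) ^ k`. -/
def paritySign (k : ℤ) : ℝ := if k % 2 = 0 then 1 else -1

theorem paritySign_mul_of_even {k l : ℤ} (h : (k - l) % 2 = 0) :
    paritySign k * paritySign l = 1 := by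
  unfold paritySign
  split_ifs <;> first | omega | norm_num

theorem paritySign_mul_of_odd {k l : ℤ} (h : (k - l) % 2 = 1) :
    paritySign k * paritySign l = -1 := by
  unfold paritySign
  split_ifs <;> first | omega | norm_num

theorem paritySign_mul_self (k : ℤ) : paritySign k * paritySign k = 1 :=
  paritySign_mul_of_even (by simp)

theorem paritySign_eq_of_even {k l : ℤ} (h : (k - l) % 2 = 0) : paritySign k = paritySign l := by
  unfold paritySign
  split_ifs <;> first | omega | rfl

/-- The relations between the coordinates of the normals of the Löbell polyhedron with `n`-fold
symmetry about the `x₃`-axis and a rotary reflection of order `2n`. -/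
structure IsCoefficients (n : ℕ) (a b c s q : ℝ) : Prop where
  five_le : 5 ≤ n
  a_pos : 0 < a
  b_pos : 0 < b
  c_pos : 0 < c
  s_pos : 0 < s
  q_pos : 0 < q
  a_sq : 2 * a ^ 2 = b ^ 2 * (Real.cos (Real.pi / n) + Real.cos (2 * (Real.pi / n)))
  b_sq : b ^ 2 * (1 - Real.cos (2 * (Real.pi / n))) = 1
  c_sq : 2 * c ^ 2 = b ^ 2 * (Real.cos (Real.pi / n) - Real.cos (2 * (Real.pi / n)))
  s_sq : 2 * Real.cos (2 * (Real.pi / n)) * s ^ 2 =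
    Real.cos (Real.pi / n) - Real.cos (2 * (Real.pi / n))
  q_sq : 2 * Real.cos (2 * (Real.pi / n)) * q ^ 2 =
    Real.cos (Real.pi / n) + Real.cos (2 * (Real.pi / n))
  q_mul_c : q * c = s * a

theorem cos_bounds {n : ℕ} (hn : 5 ≤ n) :
    1 / 2 < Real.cos (Real.pi / n) ∧ Real.cos (Real.pi / n) < 1 ∧
      0 < Real.cos (2 * (Real.pi / n)) ∧
      Real.cos (2 * (Real.pi / n)) = 2 * Real.cos (Real.pi / n) ^ 2 - 1 := by
  have hn' : (5 : ℝ) ≤ n := by exact_mod_cast hn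
  have hpi := Real.pi_pos
  have h0 : 0 < Real.pi / n := by positivity
  have h1 : 2 * (Real.pi / n) < Real.pi / 2 := by
    rw [← mul_div_assoc, div_lt_div_iff₀ (by linarith) (by norm_num)]; nlinarith
  refine ⟨?_, ?_, Real.cos_pos_of_mem_Ioo ⟨by linarith, h1⟩, Real.cos_two_mul _⟩
  · rw [← Real.cos_pi_div_three]
    exact Real.cos_lt_cos_of_nonneg_of_le_pi h0.le (by linarith) (by linarith)
  · rw [← Real.cos_zero]
    exact Real.cos_lt_cos_of_nonneg_of_le_pi le_rfl (by linarith) h0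

theorem exists_isCoefficients {n : ℕ} (hn : 5 ≤ n) : ∃ a b c s q, IsCoefficients n a b c s q := by
  obtain ⟨hx, hx1, hy, hyx⟩ := cos_bounds hn
  set x := Real.cos (Real.pi / n) with hxdef
  set y := Real.cos (2 * (Real.pi / n)) with hydef
  have hy1 : 0 < 1 - y := by nlinarith
  have hxy : 0 < x - y := by nlinarith
  have hb : 0 < √(1 / (1 - y)) := Real.sqrt_pos.mpr (by positivity)
  have hbsq : √(1 / (1 - y)) ^ 2 = 1 / (1 - y) := Real.sq_sqrt (by positivity)
  have hs : 0 < √((x - y) / (2 * y)) := Real.sqrt_pos.mpr (by positivity)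
  have hssq : √((x - y) / (2 * y)) ^ 2 = (x - y) / (2 * y) := Real.sq_sqrt (by positivity)
  have hq : 0 < √((x + y) / (2 * y)) := Real.sqrt_pos.mpr (by positivity)
  have hqsq : √((x + y) / (2 * y)) ^ 2 = (x + y) / (2 * y) := Real.sq_sqrt (by positivity)
  set b := √(1 / (1 - y))
  set s := √((x - y) / (2 * y))
  set q := √((x + y) / (2 * y))
  have hysq : √y ^ 2 = y := Real.sq_sqrt hy.le
  have hy' : 0 < √y := Real.sqrt_pos.mpr hy
  refine ⟨b * q * √y, b, b * s * √y, s, q, hn, by positivity, hb, by positivity, hs, hq, ?_, ?_,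
    ?_, ?_, ?_, by ring⟩ <;> simp only [← hxdef, ← hydef]
  · rw [mul_pow, mul_pow, hqsq, hysq]; field_simp
  · rw [hbsq]; field_simp
  · rw [mul_pow, mul_pow, hssq, hysq]; field_simp
  · rw [hssq]; field_simp
  · rw [hqsq]; field_simp

/-- The normal of the lateral face `k` of the symmetric model. -/
def modelLateral (n : ℕ) (a b c : ℝ) (k : ℤ) : Minkowski :=
  ![a, b * Real.cos (k * (Real.pi / n)), b * Real.sin (k * (Real.pi / n)), paritySign k * c]

/-- The normal of the top (for even `k`) or the bottom (for odd `k`) of the symmetric model. -/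
def modelBase (s q : ℝ) (k : ℤ) : Minkowski := ![s, 0, 0, paritySign k * q]

/-- The normals of the symmetric model, indexed by the faces. -/
def model (n : ℕ) (a b c s q : ℝ) : LFace n → Minkowski
  | LFace.top => modelBase s q 0
  | LFace.bottom => modelBase s q 1
  | LFace.upper i => modelLateral n a b c (2 * i.cast)
  | LFace.lower i => modelLateral n a b c (2 * i.cast + 1)

/-- A positive multiple of the vertex on the lateral faces `k` and `k + 2` and an `n`-gon. -/
def modelBaseVertex (n : ℕ) (a b c : ℝ) (k : ℤ) : Minkowski :=
  ![a * Real.cos (Real.pi / n),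
    b * Real.cos (2 * (Real.pi / n)) * Real.cos ((k + 1) * (Real.pi / n)),
    b * Real.cos (2 * (Real.pi / n)) * Real.sin ((k + 1) * (Real.pi / n)),
    paritySign k * (c * Real.cos (Real.pi / n))]

/-- A positive multiple of the vertex on the lateral faces `k`, `k + 1` and `k + 2`. -/
def modelLateralVertex (n : ℕ) (a b c : ℝ) (k : ℤ) : Minkowski :=
  ![b * c * (1 + Real.cos (Real.pi / n)),
    2 * (a * c) * Real.cos ((k + 1) * (Real.pi / n)),
    2 * (a * c) * Real.sin ((k + 1) * (Real.pi / n)),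
    paritySign k * ((1 - Real.cos (Real.pi / n)) * (a * b))]

theorem cos_int_mul_emod {n : ℕ} (hn : 0 < n) (m : ℤ) :
    Real.cos ((m % (2 * n) : ℤ) * (Real.pi / n)) = Real.cos (m * (Real.pi / n)) := by
  have hn0 : (n : ℝ) ≠ 0 := by positivity
  have e : (m : ℝ) * (Real.pi / n) = (m % (2 * n) : ℤ) * (Real.pi / n) +
      (m / (2 * n) : ℤ) * (2 * Real.pi) := by
    have := congrArg (Int.cast : ℤ → ℝ) (Int.emod_add_mul_ediv m (2 * n))
    push_cast at this
    rw [← this]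
    field_simp
  rw [e, Real.cos_add_int_mul_two_pi]

/-- Away from `0` modulo `2 * n` the values of `m ↦ cos (m * π / n)` are small. -/
theorem cos_int_mul_le {n : ℕ} (hn : 0 < n) {m : ℤ} {j : ℕ} (h1 : j ≤ m % (2 * n))
    (h2 : m % (2 * n) ≤ 2 * n - j) :
    Real.cos (m * (Real.pi / n)) ≤ Real.cos (j * (Real.pi / n)) := by
  have hn0 : (0 : ℝ) < n := by positivity
  have hα : 0 < Real.pi / n := by positivity
  have hnα : n * (Real.pi / n) = Real.pi := by field_simp
  rw [← cos_int_mul_emod hn]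
  generalize m % (2 * n) = r at *
  have key : ∀ r : ℤ, j ≤ r → r ≤ n →
      Real.cos (r * (Real.pi / n)) ≤ Real.cos (j * (Real.pi / n)) := fun r h1 h2 => by
    have h1' : (j : ℝ) ≤ r := by exact_mod_cast h1
    have h2' : (r : ℝ) ≤ n := by exact_mod_cast h2
    refine Real.cos_le_cos_of_nonneg_of_le_pi (by positivity) ?_
      (mul_le_mul_of_nonneg_right h1' hα.le)
    exact (mul_le_mul_of_nonneg_right h2' hα.le).trans_eq hnα
  rcases le_or_gt r n with hr | hr
  · exact key r h1 hr
  · have := key (2 * n - r) (by omega) (by omega)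
    refine le_of_eq_of_le ?_ this
    rw [← Real.cos_neg, ← Real.cos_add_two_pi]
    congr 1
    push_cast
    linear_combination -(2 : ℝ) * hnα

/-- The directions `k * α` with `k` of given parity are `2 * α` apart. -/
theorem exists_parity_abs_sub_le {α : ℝ} (hα : 0 < α) (φ : ℝ) (k₀ : ℤ) :
    ∃ k : ℤ, (k - k₀) % 2 = 0 ∧ |φ - k * α| ≤ α := by
  refine ⟨k₀ + 2 * round ((φ - k₀ * α) / (2 * α)), by omega, ?_⟩
  have h := abs_sub_round ((φ - k₀ * α) / (2 * α))
  have e : φ - ((k₀ + 2 * round ((φ - k₀ * α) / (2 * α)) : ℤ) : ℝ) * α =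
      ((φ - k₀ * α) / (2 * α) - round ((φ - k₀ * α) / (2 * α))) * (2 * α) := by
    push_cast
    field_simp
    ring
  rw [e, abs_mul, abs_of_pos (by positivity : 0 < 2 * α)]
  nlinarith

theorem exists_smul_mem_hyperbolicSpace {v : Minkowski} (hv : form v v < 0) (h0 : 0 < v 0) :
    ∃ l : ℝ, 0 < l ∧ l • v ∈ hyperbolicSpace := by
  have hl : 0 < (√(-form v v))⁻¹ := inv_pos.mpr (Real.sqrt_pos.mpr (by linarith))
  refine ⟨_, hl, ?_, mul_pos hl h0⟩
  rw [form_smul_left, form_smul_right, ← mul_assoc, ← mul_inv, Real.mul_self_sqrt (by linarith)]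
  field_simp [hv.ne]

section Model

variable {n : ℕ} {a b c s q : ℝ}

theorem modelLateral_periodic (hn : 0 < n) (k i : ℤ) :
    modelLateral n a b c (k + i * (2 * n)) = modelLateral n a b c k := by
  have hn0 : (n : ℝ) ≠ 0 := by positivity
  have e : ((k + i * (2 * n) : ℤ) : ℝ) * (Real.pi / n) =
      k * (Real.pi / n) + i * (2 * Real.pi) := by
    push_cast; field_simp
  have hs : paritySign (k + i * (2 * n)) = paritySign k :=
    paritySign_eq_of_even (by
      rw [add_sub_cancel_left, show i * (2 * (n : ℤ)) = 2 * (i * n) by ring]; omega)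
  rw [modelLateral, e, Real.cos_add_int_mul_two_pi, Real.sin_add_int_mul_two_pi, hs, modelLateral]

theorem model_lateral (hn : 0 < n) (k : ℤ) :
    model n a b c s q (lateral n k) = modelLateral n a b c k := by
  have key : ∀ i : ℤ, ∃ j : ℤ, (((i : ZMod n).cast : ℤ)) = i + j * n := fun i => by
    refine ⟨-(i / n), ?_⟩
    rw [ZMod.coe_intCast, Int.emod_def]
    ring
  obtain ⟨i, rfl | rfl⟩ := Int.even_or_odd' k <;> obtain ⟨j, hj⟩ := key i
  · rw [lateral_two_mul, model, hj]
    exact (congrArg _ (by ring)).trans (modelLateral_periodic hn (2 * i) j)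
  · rw [lateral_two_mul_add_one, model, hj]
    exact (congrArg _ (by ring)).trans (modelLateral_periodic hn (2 * i + 1) j)

theorem model_base (k : ℤ) : model n a b c s q (base n k) = modelBase s q k := by
  unfold base
  split_ifs with h <;> simp [model, modelBase, paritySign, h]

theorem form_modelLateral (k l : ℤ) : form (modelLateral n a b c k) (modelLateral n a b c l) =
    -a ^ 2 + b ^ 2 * Real.cos ((k - l : ℤ) * (Real.pi / n)) +
      paritySign k * paritySign l * c ^ 2 := by
  push_cast
  rw [sub_mul, Real.cos_sub]
  simp only [form, modelLateral, Matrix.cons_val]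
  ring

theorem form_modelBase_modelLateral (k l : ℤ) :
    form (modelBase s q k) (modelLateral n a b c l) =
      -(s * a) + paritySign k * paritySign l * (q * c) := by
  simp only [form, modelLateral, modelBase, Matrix.cons_val]
  ring

theorem form_modelBase (k l : ℤ) :
    form (modelBase s q k) (modelBase s q l) = -s ^ 2 + paritySign k * paritySign l * q ^ 2 := by
  simp only [form, modelBase, Matrix.cons_val]
  ring

theorem form_modelBaseVertex (k l : ℤ) :
    form (modelBaseVertex n a b c k) (modelLateral n a b c l) =
      Real.cos (Real.pi / n) * (-a ^ 2 + paritySign k * paritySign l * c ^ 2) +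
      b ^ 2 * Real.cos (2 * (Real.pi / n)) * Real.cos ((l - (k + 1) : ℤ) * (Real.pi / n)) := by
  push_cast
  rw [sub_mul, Real.cos_sub]
  simp only [form, modelLateral, modelBaseVertex, Matrix.cons_val]
  ring

theorem form_modelLateralVertex (k l : ℤ) :
    form (modelLateralVertex n a b c k) (modelLateral n a b c l) =
      a * b * c * (-(1 + Real.cos (Real.pi / n)) +
        2 * Real.cos ((l - (k + 1) : ℤ) * (Real.pi / n)) +
        paritySign k * paritySign l * (1 - Real.cos (Real.pi / n))) := by
  push_cast
  rw [sub_mul, Real.cos_sub]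
  simp only [form, modelLateral, modelLateralVertex, Matrix.cons_val]
  ring

theorem form_modelLateralVertex_of_even {k l : ℤ} (hkl : (k - l) % 2 = 0) :
    form (modelLateralVertex n a b c k) (modelLateral n a b c l) = 2 * (a * b * c) *
        (Real.cos ((l - (k + 1) : ℤ) * (Real.pi / n)) - Real.cos (Real.pi / n)) := by
  rw [form_modelLateralVertex, paritySign_mul_of_even hkl]
  ring

theorem form_modelLateralVertex_of_odd {k l : ℤ} (hkl : (k - l) % 2 = 1) :
    form (modelLateralVertex n a b c k) (modelLateral n a b c l) = 2 * (a * b * c) *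
        (Real.cos ((l - (k + 1) : ℤ) * (Real.pi / n)) - 1) := by
  rw [form_modelLateralVertex, paritySign_mul_of_odd hkl]
  ring

end Model

namespace IsCoefficients

variable {n : ℕ} {a b c s q : ℝ} (h : IsCoefficients n a b c s q)
include h

theorem n_pos : 0 < n := by have := h.five_le; omega

theorem form_modelLateral_of_even {k l : ℤ} (hkl : (k - l) % 2 = 0) :
    form (modelLateral n a b c k) (modelLateral n a b c l) =
      b ^ 2 * (Real.cos ((k - l : ℤ) * (Real.pi / n)) - Real.cos (2 * (Real.pi / n))) := by
  rw [form_modelLateral, paritySign_mul_of_even hkl]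
  linear_combination (-1 / 2 : ℝ) * h.a_sq + (1 / 2 : ℝ) * h.c_sq

theorem form_modelLateral_of_odd {k l : ℤ} (hkl : (k - l) % 2 = 1) :
    form (modelLateral n a b c k) (modelLateral n a b c l) =
      b ^ 2 * (Real.cos ((k - l : ℤ) * (Real.pi / n)) - Real.cos (Real.pi / n)) := by
  rw [form_modelLateral, paritySign_mul_of_odd hkl]
  linear_combination (-1 / 2 : ℝ) * h.a_sq - (1 / 2 : ℝ) * h.c_sq

theorem form_modelLateral_self (k : ℤ) :
    form (modelLateral n a b c k) (modelLateral n a b c k) = 1 := by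
  rw [h.form_modelLateral_of_even (by simp)]
  simpa using h.b_sq

theorem form_modelLateral_one (k : ℤ) :
    form (modelLateral n a b c k) (modelLateral n a b c (k + 1)) = 0 := by
  rw [form_comm, h.form_modelLateral_of_odd (by omega)]
  simp

theorem form_modelLateral_two (k : ℤ) :
    form (modelLateral n a b c k) (modelLateral n a b c (k + 2)) = 0 := by
  rw [form_comm, h.form_modelLateral_of_even (by omega)]
  simp

theorem form_modelBase_self (k : ℤ) : form (modelBase s q k) (modelBase s q k) = 1 := by
  obtain ⟨-, -, hy, -⟩ := cos_bounds h.five_le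
  rw [form_modelBase, paritySign_mul_self]
  refine mul_left_cancel₀ hy.ne' ?_
  linear_combination (-1 / 2 : ℝ) * h.s_sq + (1 / 2 : ℝ) * h.q_sq

theorem form_modelBase_lt {k l : ℤ} (hkl : (k - l) % 2 = 1) :
    form (modelBase s q k) (modelBase s q l) < -1 := by
  have e := h.form_modelBase_self k
  have hs := h.s_pos
  rw [form_modelBase, paritySign_mul_self] at e
  rw [form_modelBase, paritySign_mul_of_odd hkl]
  nlinarith

theorem form_modelBase_modelLateral_of_even {k l : ℤ} (hkl : (k - l) % 2 = 0) :
    form (modelBase s q k) (modelLateral n a b c l) = 0 := by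
  rw [form_modelBase_modelLateral, paritySign_mul_of_even hkl, h.q_mul_c]
  ring

theorem form_modelBase_modelLateral_lt {k l : ℤ} (hkl : (k - l) % 2 = 1) :
    form (modelBase s q k) (modelLateral n a b c l) < -1 := by
  obtain ⟨-, -, hy, hyx⟩ := cos_bounds h.five_le
  have hsa := mul_pos h.s_pos h.a_pos
  have e1 := h.a_sq
  have e2 := h.s_sq
  have e3 := h.b_sq
  rw [form_modelBase_modelLateral, paritySign_mul_of_odd hkl, h.q_mul_c]
  generalize Real.cos (2 * (Real.pi / n)) = y at *
  generalize Real.cos (Real.pi / n) = x at *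
  have key : y * (4 * (s * a) ^ 2) = y + 1 / 2 := by
    linear_combination (2 * y * s ^ 2) * e1 + b ^ 2 * (x + y) * e2 +
      (y + 1 / 2) * e3 - b ^ 2 * (1 / 2) * hyx
  have : 1 < 4 * (s * a) ^ 2 := by
    by_contra hle
    nlinarith [mul_le_mul_of_nonneg_left (not_lt.mp hle) hy.le]
  nlinarith

/-- The planes of two lateral faces whose indices differ by more than `2` are ultraparallel. -/
theorem form_modelLateral_lt {k l : ℤ} (h1 : 3 ≤ (k - l) % (2 * n))
    (h2 : (k - l) % (2 * n) ≤ 2 * n - 3) :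
    form (modelLateral n a b c k) (modelLateral n a b c l) < -1 := by
  obtain ⟨hx, hx1, hy, hyx⟩ := cos_bounds h.five_le
  have hb := h.b_sq
  have hb0 : 0 < b ^ 2 := pow_pos h.b_pos 2
  have hpar : (k - l) % (2 * n) % 2 = (k - l) % 2 := Int.emod_emod_of_dvd _ ⟨n, rfl⟩
  rcases Int.emod_two_eq_zero_or_one (k - l) with hkl | hkl
  · rw [h.form_modelLateral_of_even hkl]
    have hcos := cos_int_mul_le (j := 4) h.n_pos (m := k - l) (by push_cast; omega)
      (by push_cast; omega)
    rw [show ((4 : ℕ) : ℝ) * (Real.pi / n) = 2 * (2 * (Real.pi / n)) by push_cast; ring,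
      Real.cos_two_mul (2 * (Real.pi / n))] at hcos
    have := mul_le_mul_of_nonneg_left hcos hb0.le
    generalize Real.cos (2 * (Real.pi / n)) = y at *
    nlinarith
  · rw [h.form_modelLateral_of_odd hkl]
    have hcos := cos_int_mul_le (j := 3) h.n_pos (m := k - l) (by push_cast; omega)
      (by push_cast; omega)
    rw [show ((3 : ℕ) : ℝ) * (Real.pi / n) = 3 * (Real.pi / n) by push_cast; ring,
      Real.cos_three_mul (Real.pi / n)] at hcos
    have := mul_le_mul_of_nonneg_left hcos hb0.le
    rw [hyx] at hb
    generalize Real.cos (Real.pi / n) = x at *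
    have e : b ^ 2 * (4 * x ^ 3 - 3 * x - x) = -(2 * x) := by
      linear_combination -(2 * x) * hb
    linarith

theorem cos_le_of_odd {m : ℤ} (hm : m % 2 = 1) :
    Real.cos (m * (Real.pi / n)) ≤ Real.cos (Real.pi / n) := by
  have := h.five_le
  have hpar : m % (2 * n) % 2 = m % 2 := Int.emod_emod_of_dvd _ ⟨n, rfl⟩
  have h1 := Int.emod_nonneg m (b := 2 * n) (by omega)
  have h2 := Int.emod_lt_of_pos m (b := 2 * n) (by omega)
  simpa using cos_int_mul_le (j := 1) h.n_pos (m := m) (by push_cast; omega) (by push_cast; omega)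

theorem form_modelBaseVertex_of_even {k l : ℤ} (hkl : (k - l) % 2 = 0) :
    form (modelBaseVertex n a b c k) (modelLateral n a b c l) =
      b ^ 2 * Real.cos (2 * (Real.pi / n)) *
        (Real.cos ((l - (k + 1) : ℤ) * (Real.pi / n)) - Real.cos (Real.pi / n)) := by
  rw [form_modelBaseVertex, paritySign_mul_of_even hkl]
  linear_combination Real.cos (Real.pi / n) * ((-1 / 2 : ℝ) * h.a_sq + (1 / 2 : ℝ) * h.c_sq)

theorem form_modelBaseVertex_nonpos (k l : ℤ) :
    form (modelBaseVertex n a b c k) (modelLateral n a b c l) ≤ 0 := by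
  obtain ⟨hx, hx1, hy, hyx⟩ := cos_bounds h.five_le
  have hb0 : 0 < b ^ 2 := pow_pos h.b_pos 2
  rcases Int.emod_two_eq_zero_or_one (k - l) with hkl | hkl
  · rw [h.form_modelBaseVertex_of_even hkl]
    have := h.cos_le_of_odd (m := l - (k + 1)) (by omega)
    exact mul_nonpos_of_nonneg_of_nonpos (by positivity) (by linarith)
  · rw [form_modelBaseVertex, paritySign_mul_of_odd hkl]
    have e1 := h.a_sq
    have e2 := h.c_sq
    have hcos := Real.cos_le_one ((l - (k + 1) : ℤ) * (Real.pi / n))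
    have := mul_le_mul_of_nonneg_left hcos (mul_pos hb0 hy).le
    generalize Real.cos (2 * (Real.pi / n)) = y at *
    generalize Real.cos (Real.pi / n) = x at *
    have e : x * (-a ^ 2 + -1 * c ^ 2) = -(b ^ 2 * x ^ 2) := by
      linear_combination (-x / 2) * e1 - (x / 2) * e2
    have : b ^ 2 * y ≤ b ^ 2 * x ^ 2 := mul_le_mul_of_nonneg_left (by nlinarith) hb0.le
    linarith

theorem form_modelBaseVertex_modelBase (k l : ℤ) :
    form (modelBaseVertex n a b c k) (modelBase s q l) =
      Real.cos (Real.pi / n) * (s * a) * (paritySign k * paritySign l - 1) := by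
  simp only [form, modelBase, modelBaseVertex, Matrix.cons_val]
  linear_combination paritySign k * paritySign l * Real.cos (Real.pi / n) * h.q_mul_c

theorem form_modelBaseVertex_self_neg (k : ℤ) :
    form (modelBaseVertex n a b c k) (modelBaseVertex n a b c k) < 0 := by
  obtain ⟨hx, hx1, hy, hyx⟩ := cos_bounds h.five_le
  have hb0 : 0 < b ^ 2 := pow_pos h.b_pos 2
  have e1 := h.a_sq
  have e2 := h.c_sq
  have e3 := Real.cos_sq_add_sin_sq ((k + 1) * (Real.pi / n))
  have e4 := paritySign_mul_self k
  simp only [form, modelBaseVertex, Matrix.cons_val]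
  generalize Real.cos (2 * (Real.pi / n)) = y at *
  generalize Real.cos (Real.pi / n) = x at *
  have hxy : y < x ^ 2 := by nlinarith
  refine lt_of_eq_of_lt (b := -(b ^ 2 * y * (x ^ 2 - y))) ?_ ?_
  · linear_combination (-x ^ 2 / 2) * e1 + (x ^ 2 / 2) * e2 + b ^ 2 * y ^ 2 * e3 +
      c ^ 2 * x ^ 2 * e4
  · have := mul_pos (mul_pos hb0 hy) (sub_pos.mpr hxy)
    linarith

theorem form_modelLateralVertex_nonpos (k l : ℤ) :
    form (modelLateralVertex n a b c k) (modelLateral n a b c l) ≤ 0 := by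
  have habc := mul_pos (mul_pos h.a_pos h.b_pos) h.c_pos
  rcases Int.emod_two_eq_zero_or_one (k - l) with hkl | hkl
  · rw [form_modelLateralVertex_of_even hkl]
    have := h.cos_le_of_odd (m := l - (k + 1)) (by omega)
    exact mul_nonpos_of_nonneg_of_nonpos (by positivity) (by linarith)
  · rw [form_modelLateralVertex_of_odd hkl]
    have := Real.cos_le_one ((l - (k + 1) : ℤ) * (Real.pi / n))
    exact mul_nonpos_of_nonneg_of_nonpos (by positivity) (by linarith)

theorem form_modelLateralVertex_modelBase_nonpos (k l : ℤ) :
    form (modelLateralVertex n a b c k) (modelBase s q l) ≤ 0 := by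
  obtain ⟨hx, hx1, hy, hyx⟩ := cos_bounds h.five_le
  have e : form (modelLateralVertex n a b c k) (modelBase s q l) =
      -(b * c * s * (1 + Real.cos (Real.pi / n))) +
        paritySign k * paritySign l * (a * b * q * (1 - Real.cos (Real.pi / n))) := by
    simp only [form, modelBase, modelLateralVertex, Matrix.cons_val]
    ring
  rw [e]
  have hb0 := h.b_pos
  have ha0 := h.a_pos
  have hc0 := h.c_pos
  have hs0 := h.s_pos
  have hq0 := h.q_pos
  have e1 := h.a_sq
  have e2 := h.c_sq
  have e5 := h.q_mul_c
  generalize Real.cos (2 * (Real.pi / n)) = y at *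
  generalize Real.cos (Real.pi / n) = x at *
  have hp1 : 0 < b * c * s * (1 + x) := mul_pos (by positivity) (by linarith)
  have hp2 : 0 < a * b * q * (1 - x) := mul_pos (by positivity) (by linarith)
  have hle : a * b * q * (1 - x) ≤ b * c * s * (1 + x) := by
    refine le_of_mul_le_mul_left ?_ ha0
    have hxy : 0 ≤ b * q * (b ^ 2 * (x ^ 2 - y)) :=
      mul_nonneg (by positivity) (mul_nonneg (by positivity) (by nlinarith))
    have : a * (b * c * s * (1 + x)) - a * (a * b * q * (1 - x)) =
        b * q * (b ^ 2 * (x ^ 2 - y)) := by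
      linear_combination (-(b * c) * (1 + x)) * e5 + (b * q * (1 + x) / 2) * e2 -
        (b * q * (1 - x) / 2) * e1
    linarith
  rcases Int.emod_two_eq_zero_or_one (k - l) with hkl | hkl
  · rw [paritySign_mul_of_even hkl]; linarith
  · rw [paritySign_mul_of_odd hkl]; linarith

theorem form_modelLateralVertex_self_neg (k : ℤ) :
    form (modelLateralVertex n a b c k) (modelLateralVertex n a b c k) < 0 := by
  obtain ⟨hx, hx1, hy, hyx⟩ := cos_bounds h.five_le
  have hb0 := h.b_pos
  have e1 := h.a_sq
  have e2 := h.c_sq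
  have e3 := Real.cos_sq_add_sin_sq ((k + 1) * (Real.pi / n))
  have e4 := paritySign_mul_self k
  simp only [form, modelLateralVertex, Matrix.cons_val]
  generalize Real.cos (2 * (Real.pi / n)) = y at *
  generalize Real.cos (Real.pi / n) = x at *
  have hxy : 0 < 1 - x ^ 2 := by nlinarith
  refine lt_of_eq_of_lt (b := -(2 * b ^ 4 * (1 - x ^ 2) ^ 2)) ?_ ?_
  · rw [hyx] at e1 e2
    linear_combination (4 * a ^ 2 * c ^ 2) * e3 + (1 - x) ^ 2 * a ^ 2 * b ^ 2 * e4 +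
      (2 * c ^ 2 + (1 - x) ^ 2 * b ^ 2 / 2) * e1 +
      (b ^ 2 * (x + (2 * x ^ 2 - 1)) - b ^ 2 * (1 + x) ^ 2 / 2) * e2
  · have : 0 < 2 * b ^ 4 * (1 - x ^ 2) ^ 2 := by positivity
    linarith

end IsCoefficients

theorem base_eq_of_parity {n : ℕ} {k l : ℤ} (h : (k - l) % 2 = 0) : base n k = base n l := by
  have : k % 2 = l % 2 := by omega
  simp only [base, this]

theorem face_cases_base {n : ℕ} (f : LFace n) : (∃ j, f = base n j) ∨ ∃ k, f = lateral n k := by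
  rcases face_cases f with rfl | rfl | hk
  · exact Or.inl ⟨0, base_zero.symm⟩
  · exact Or.inl ⟨1, base_one.symm⟩
  · exact Or.inr hk

/-- The cone cut out by `d ≤ t * w` and `r ^ 2 ≤ κ * (w - t * d) ^ 2` lies inside the light cone
`r ^ 2 + d ^ 2 ≤ w ^ 2`, which it meets only in the origin; so it has a bounded intersection with
the hyperboloid. -/
theorem le_one_div_of_cone {κ t r d w : ℝ} (hκ0 : 0 < κ) (hκ1 : κ < 1) (ht0 : 0 < t)
    (ht1 : t ^ 2 < 1) (hw : 0 < w) (hd : 0 ≤ d) (hdw : d ≤ t * w)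
    (hr : r ^ 2 ≤ κ * (w - t * d) ^ 2) (h : w ^ 2 = 1 + r ^ 2 + d ^ 2) :
    w ≤ 1 / ((1 - κ) * (1 - t ^ 2)) := by
  have hpos : 0 < (1 - κ) * (1 - t ^ 2) := mul_pos (by linarith) (by linarith)
  have hd0 : 0 ≤ w - t * d := by
    have h1 : t * d ≤ t * (t * w) := mul_le_mul_of_nonneg_left hdw ht0.le
    have h2 : t ^ 2 * w < 1 * w := mul_lt_mul_of_pos_right ht1 hw
    linarith
  have h1 : κ * (w - t * d) ^ 2 ≤ κ * (w * (w - t * d)) := by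
    refine mul_le_mul_of_nonneg_left ?_ hκ0.le
    rw [sq]
    exact mul_le_mul_of_nonneg_right (by linarith [mul_nonneg ht0.le hd]) hd0
  have h2 : d ^ 2 ≤ t * w * d := by
    rw [sq]; exact mul_le_mul_of_nonneg_right hdw hd
  have h3 : (1 - κ) * (t * w) * d ≤ (1 - κ) * (t * w) * (t * w) :=
    mul_le_mul_of_nonneg_left hdw (mul_nonneg (by linarith) (mul_nonneg ht0.le hw.le))
  have h4 : (1 - κ) * (1 - t ^ 2) * w ^ 2 ≤ 1 := by linarith
  have hw1 : 1 ≤ w := by nlinarith [sq_nonneg r, sq_nonneg d]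
  rw [le_div_iff₀ hpos]
  have := mul_le_mul_of_nonneg_left (le_self_pow₀ hw1 two_ne_zero) hpos.le
  linarith

namespace IsCoefficients

variable {n : ℕ} {a b c s q : ℝ} (h : IsCoefficients n a b c s q)
include h

theorem model_self (f : LFace n) :
    form (model n a b c s q f) (model n a b c s q f) = 1 := by
  rcases face_cases_base f with ⟨j, rfl⟩ | ⟨k, rfl⟩
  · rw [model_base]; exact h.form_modelBase_self j
  · rw [model_lateral h.n_pos]; exact h.form_modelLateral_self k

theorem mem_polyhedron_model {x : Minkowski} (hx : x ∈ hyperbolicSpace)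
    (hF : ∀ k, form x (modelLateral n a b c k) ≤ 0) (hN : ∀ k, form x (modelBase s q k) ≤ 0) :
    x ∈ polyhedron (model n a b c s q) := by
  refine ⟨hx, fun f => ?_⟩
  rcases face_cases_base f with ⟨j, rfl⟩ | ⟨k, rfl⟩
  · rw [model_base]; exact hN j
  · rw [model_lateral h.n_pos]; exact hF k

/-! ### The vertices of the symmetric model -/

theorem exists_mem_polyhedron_model {w : Minkowski} (hw : form w w < 0) (hw0 : 0 < w 0)
    (hF : ∀ k, form w (modelLateral n a b c k) ≤ 0) (hN : ∀ k, form w (modelBase s q k) ≤ 0) :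
    ∃ x ∈ polyhedron (model n a b c s q), ∀ f, form w (model n a b c s q f) = 0 →
      x ∈ face (model n a b c s q) f := by
  obtain ⟨l, hl, hlw⟩ := exists_smul_mem_hyperbolicSpace hw hw0
  have hmem : l • w ∈ polyhedron (model n a b c s q) := h.mem_polyhedron_model hlw
    (fun k => by rw [form_smul_left]; exact mul_nonpos_of_nonneg_of_nonpos hl.le (hF k))
    (fun k => by rw [form_smul_left]; exact mul_nonpos_of_nonneg_of_nonpos hl.le (hN k))
  exact ⟨l • w, hmem, fun f hf => ⟨hmem, by rw [form_smul_left, hf, mul_zero]⟩⟩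

theorem exists_vertex_model {v : Set (LFace n)} (hv : v ∈ vertices n) :
    ∃ x ∈ polyhedron (model n a b c s q), ∀ f ∈ v, x ∈ face (model n a b c s q) f := by
  obtain ⟨hx, hx1, hy, hyx⟩ := cos_bounds h.five_le
  have ha := h.a_pos
  have hb := h.b_pos
  have hc := h.c_pos
  have hs := h.s_pos
  obtain ⟨k, rfl | rfl⟩ := mem_vertices_iff.mp hv
  · obtain ⟨x, hxP, hxf⟩ := h.exists_mem_polyhedron_model (h.form_modelLateralVertex_self_neg k)
      (by simp only [modelLateralVertex, Matrix.cons_val_zero]; positivity)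
      (h.form_modelLateralVertex_nonpos k) (h.form_modelLateralVertex_modelBase_nonpos k)
    refine ⟨x, hxP, ?_⟩
    rintro f (rfl | rfl | rfl) <;> apply hxf <;> rw [model_lateral h.n_pos]
    · rw [form_modelLateralVertex_of_even (by simp)]
      simp
    · rw [form_modelLateralVertex_of_odd (by omega)]
      simp
    · rw [form_modelLateralVertex_of_even (by omega)]
      simp [show k + 2 - (k + 1) = 1 by ring]
  · obtain ⟨x, hxP, hxf⟩ := h.exists_mem_polyhedron_model (h.form_modelBaseVertex_self_neg k)
      (by simp only [modelBaseVertex, Matrix.cons_val_zero]; positivity)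
      (h.form_modelBaseVertex_nonpos k) (fun l => by
        rw [h.form_modelBaseVertex_modelBase]
        have hp : paritySign k * paritySign l ≤ 1 := by
          rcases Int.emod_two_eq_zero_or_one (k - l) with hkl | hkl
          · rw [paritySign_mul_of_even hkl]
          · rw [paritySign_mul_of_odd hkl]; norm_num
        exact mul_nonpos_of_nonneg_of_nonpos (by positivity) (by linarith))
    refine ⟨x, hxP, ?_⟩
    rintro f (rfl | rfl | rfl) <;> apply hxf
    · rw [model_base, h.form_modelBaseVertex_modelBase, paritySign_mul_self]
      simp
    · rw [model_lateral h.n_pos, h.form_modelBaseVertex_of_even (by simp)]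
      simp
    · rw [model_lateral h.n_pos, h.form_modelBaseVertex_of_even (by omega)]
      simp [show k + 2 - (k + 1) = 1 by ring]

/-- The faces through a point of the symmetric model belong to a common vertex: their planes meet
pairwise, so that they are pairwise adjacent, and pairwise adjacent faces share a vertex. -/
theorem exists_vertex_of_mem_model {x : Minkowski} (hx : x ∈ hyperbolicSpace) :
    ∃ v ∈ vertices n, ∀ f, x ∈ face (model n a b c s q) f → f ∈ v := by
  have h5 := h.five_le
  set K : ℤ → Prop := fun k => x ∈ face (model n a b c s q) (lateral n k) with hKdef
  set J : ℤ → Prop := fun j => x ∈ face (model n a b c s q) (base n j) with hJdef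
  have hKform : ∀ k, K k → form x (modelLateral n a b c k) = 0 := fun k hk => by
    have := hk.2
    rwa [model_lateral h.n_pos] at this
  have hJform : ∀ j, J j → form x (modelBase s q j) = 0 := fun j hj => by
    have := hj.2
    rwa [model_base] at this
  have hKK : ∀ k l, K k → K l → (k - l) % (2 * n) < 3 ∨ 2 * n - 3 < (k - l) % (2 * n) :=
    fun k l hk hl => by
      by_contra! hcon
      exact not_form_lt_neg_one hx.1 (h.form_modelLateral_self k) (h.form_modelLateral_self l)
        (hKform k hk) (hKform l hl) (h.form_modelLateral_lt hcon.1 hcon.2)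
  have hJK : ∀ j k, J j → K k → (j - k) % 2 = 0 := fun j k hj hk => by
    refine (Int.emod_two_eq_zero_or_one _).resolve_right fun hodd => ?_
    exact not_form_lt_neg_one hx.1 (h.form_modelBase_self j) (h.form_modelLateral_self k)
      (hJform j hj) (hKform k hk) (h.form_modelBase_modelLateral_lt hodd)
  have hJJ : ∀ i j, J i → J j → (i - j) % 2 = 0 := fun i j hi hj => by
    refine (Int.emod_two_eq_zero_or_one _).resolve_right fun hodd => ?_
    exact not_form_lt_neg_one hx.1 (h.form_modelBase_self i) (h.form_modelBase_self j)
      (hJform i hi) (hJform j hj) (h.form_modelBase_lt hodd)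
  by_cases hK : ∃ k, K k
  · obtain ⟨k, hk⟩ := hK
    have hnear : ∀ i j, K i → K j → i ≤ j → j ≤ i + 4 → j ≤ i + 2 := fun i j hi hj h1 h2 => by
      have := hKK j i hj hi
      rw [Int.emod_eq_of_lt (by omega) (by omega)] at this
      omega
    have hrep : ∀ l, K l → ∃ l', K l' ∧ lateral n l = lateral n l' ∧ k - 2 ≤ l' ∧ l' ≤ k + 2 :=
      fun l hl => by
        have hmod := Int.emod_add_mul_ediv (l - k) (2 * n)
        have hlt := Int.emod_lt_of_pos (l - k) (b := 2 * n) (by omega)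
        have h0 := Int.emod_nonneg (l - k) (b := 2 * n) (by omega)
        rcases hKK l k hl hk with hr | hr
        · have e : lateral n l = lateral n (k + (l - k) % (2 * n)) :=
            lateral_eq_iff.mpr ⟨(l - k) / (2 * n), by linarith⟩
          refine ⟨_, ?_, e, by omega, by omega⟩
          simp only [hKdef] at hl ⊢
          rwa [← e]
        · have e : lateral n l = lateral n (k + (l - k) % (2 * n) - 2 * n) :=
            lateral_eq_iff.mpr ⟨(l - k) / (2 * n) + 1, by linarith⟩
          refine ⟨_, ?_, e, by omega, by omega⟩
          simp only [hKdef] at hl ⊢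
          rwa [← e]
    -- the first index of the faces through `x`
    obtain ⟨k₀, hk₀, hall⟩ : ∃ k₀, K k₀ ∧ ∀ l, K l → lateral n l = lateral n k₀ ∨
        (K (k₀ + 1) ∧ lateral n l = lateral n (k₀ + 1)) ∨ lateral n l = lateral n (k₀ + 2) := by
      have key : ∀ k₀, K k₀ → k - 2 ≤ k₀ → k₀ ≤ k → (∀ l, K l → k - 2 ≤ l → k₀ ≤ l) →
          ∀ l, K l → lateral n l = lateral n k₀ ∨
            (K (k₀ + 1) ∧ lateral n l = lateral n (k₀ + 1)) ∨
            lateral n l = lateral n (k₀ + 2) := fun k₀ h0 h1 h2 hmin l hl => by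
        obtain ⟨l', hl', e, h3, h4⟩ := hrep l hl
        have h5 := hmin l' hl' h3
        have h6 := hnear k₀ l' h0 hl' h5 (by omega)
        rw [e]
        obtain rfl | rfl | rfl : l' = k₀ ∨ l' = k₀ + 1 ∨ l' = k₀ + 2 := by omega
        · exact Or.inl rfl
        · exact Or.inr (Or.inl ⟨hl', rfl⟩)
        · exact Or.inr (Or.inr rfl)
      by_cases h2 : K (k - 2)
      · exact ⟨k - 2, h2, key _ h2 (by omega) (by omega) fun l _ hl => hl⟩
      · have hne2 : ∀ l, K l → l ≠ k - 2 := fun l hl e => h2 (e ▸ hl)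
        by_cases h1 : K (k - 1)
        · exact ⟨k - 1, h1, key _ h1 (by omega) (by omega) fun l hKl hl => by
            have := hne2 l hKl; omega⟩
        · have hne1 : ∀ l, K l → l ≠ k - 1 := fun l hl e => h1 (e ▸ hl)
          exact ⟨k, hk, key _ hk (by omega) (by omega) fun l hKl hl => by
            have := hne2 l hKl; have := hne1 l hKl; omega⟩
    by_cases hJ : J k₀
    · refine ⟨_, mem_vertices_iff.mpr ⟨k₀, Or.inr rfl⟩, fun f hf => ?_⟩
      rcases face_cases_base f with ⟨j, rfl⟩ | ⟨l, rfl⟩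
      · exact Or.inl (base_eq_of_parity (hJJ j k₀ hf hJ))
      · rcases hall l hf with e | ⟨h1, -⟩ | e
        · exact Or.inr (Or.inl e)
        · have := hJK k₀ (k₀ + 1) hJ h1
          omega
        · exact Or.inr (Or.inr e)
    · refine ⟨_, mem_vertices_iff.mpr ⟨k₀, Or.inl rfl⟩, fun f hf => ?_⟩
      rcases face_cases_base f with ⟨j, rfl⟩ | ⟨l, rfl⟩
      · refine absurd ?_ hJ
        simp only [hJdef]
        rwa [← base_eq_of_parity (hJK j k₀ hf hk₀)]
      · rcases hall l hf with e | ⟨-, e⟩ | e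
        · exact Or.inl e
        · exact Or.inr (Or.inl e)
        · exact Or.inr (Or.inr e)
  · push Not at hK
    obtain ⟨i, hi⟩ : ∃ i, ∀ j, J j → (j - i) % 2 = 0 := by
      by_cases hJ : ∃ i, J i
      · obtain ⟨i, hi⟩ := hJ
        exact ⟨i, fun j hj => hJJ j i hj hi⟩
      · push Not at hJ
        exact ⟨0, fun j hj => absurd hj (hJ j)⟩
    refine ⟨_, mem_vertices_iff.mpr ⟨i, Or.inr rfl⟩, fun f hf => ?_⟩
    rcases face_cases_base f with ⟨j, rfl⟩ | ⟨l, rfl⟩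
    · exact Or.inl (base_eq_of_parity (hi j hf))
    · exact absurd hf (hK l)

theorem hasLoebellType_model : HasLoebellType (model n a b c s q) := fun S => by
  constructor
  · rintro ⟨x, hx, hS⟩
    obtain ⟨v, hv, hsub⟩ := h.exists_vertex_of_mem_model hx.1
    exact ⟨v, hv, fun f hf => hsub f (hS f hf)⟩
  · rintro ⟨v, hv, hS⟩
    obtain ⟨x, hx, hxv⟩ := h.exists_vertex_model hv
    exact ⟨x, hx, fun f hf => hxv f (hS hf)⟩

theorem form_model_eq_zero {v : Set (LFace n)} (hv : v ∈ vertices n) {f g : LFace n} (hf : f ∈ v)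
    (hg : g ∈ v) (hfg : f ≠ g) : form (model n a b c s q f) (model n a b c s q g) = 0 := by
  have e1 := h.form_modelLateral_one
  have e2 := h.form_modelLateral_two
  have e3 := fun k => h.form_modelLateral_one (k + 1)
  simp only [show ∀ k : ℤ, k + 1 + 1 = k + 2 from fun k => by ring] at e3
  have e4 := fun k => h.form_modelBase_modelLateral_of_even (k := k) (l := k) (by simp)
  have e5 := fun k => h.form_modelBase_modelLateral_of_even (k := k) (l := k + 2) (by omega)
  have key : ∀ {p r t : LFace n}, form (model n a b c s q p) (model n a b c s q r) = 0 →
      form (model n a b c s q p) (model n a b c s q t) = 0 →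
      form (model n a b c s q r) (model n a b c s q t) = 0 → v = {p, r, t} →
      form (model n a b c s q f) (model n a b c s q g) = 0 := by
    rintro p r t h1 h2 h3 rfl
    rcases hf with rfl | rfl | rfl <;> rcases hg with rfl | rfl | rfl <;>
      first | exact absurd rfl hfg | assumption | (rw [form_comm]; assumption)
  obtain ⟨k, hk | hk⟩ := mem_vertices_iff.mp hv <;> refine key ?_ ?_ ?_ hk <;>
    simp only [model_lateral h.n_pos, model_base]
  exacts [e1 k, e2 k, e3 k, e4 k, e5 k, e2 k]

/-! ### Compactness of the symmetric model -/

/-- The `n`-gon on the same side as the point `x` bounds `|x 3|`, and a lateral face adjacent to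
that `n`-gon, in a direction within `π / n` of that of `(x 1, x 2)`, bounds the distance from the
axis. -/
theorem exists_bound_model : ∃ R, ∀ x ∈ polyhedron (model n a b c s q), x 0 ≤ R := by
  obtain ⟨hx, hx1, hy, hyx⟩ := cos_bounds h.five_le
  have ha := h.a_pos
  have hb := h.b_pos
  have hc := h.c_pos
  have hs := h.s_pos
  have hq := h.q_pos
  have hα : 0 < Real.pi / n := by have := h.n_pos; positivity
  have hαpi : Real.pi / n ≤ Real.pi :=
    div_le_self Real.pi_pos.le (by have := h.n_pos; exact_mod_cast this)
  set κ := a ^ 2 / (b ^ 2 * Real.cos (Real.pi / n) ^ 2) with hκ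
  set t := c / a with ht
  have hκ0 : 0 < κ := by positivity
  have hκ1 : κ < 1 := by
    rw [hκ, div_lt_one (by positivity)]
    have := h.a_sq
    nlinarith [mul_pos (pow_pos hb 2) (sub_pos.mpr hx1)]
  have ht0 : 0 < t := by positivity
  have ht1 : t ^ 2 < 1 := by
    rw [ht, div_pow, div_lt_one (by positivity)]
    have := h.a_sq
    have := h.c_sq
    nlinarith [mul_pos (pow_pos hb 2) hy]
  refine ⟨1 / ((1 - κ) * (1 - t ^ 2)), fun p hp => ?_⟩
  obtain ⟨⟨hp1, hp0⟩, hpf⟩ := hp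
  have hF : ∀ k, form p (modelLateral n a b c k) ≤ 0 := fun k => by
    have := hpf (lateral n k)
    rwa [model_lateral h.n_pos] at this
  have hN : ∀ k, form p (modelBase s q k) ≤ 0 := fun k => by
    have := hpf (base n k)
    rwa [model_base] at this
  obtain ⟨k₀, hk₀⟩ : ∃ k₀ : ℤ, paritySign k₀ * p 3 = |p 3| := by
    rcases le_total 0 (p 3) with h3 | h3
    · exact ⟨0, by simp [paritySign, abs_of_nonneg h3]⟩
    · exact ⟨1, by simp [paritySign, abs_of_nonpos h3]⟩
  have h3 : |p 3| ≤ t * p 0 := by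
    have := hN k₀
    simp only [form, modelBase, Matrix.cons_val] at this
    have h1 : q * |p 3| ≤ s * p 0 := by rw [← hk₀]; linarith
    have h2 : s = q * t := by
      rw [ht]; field_simp; linarith [h.q_mul_c]
    rw [h2, mul_assoc] at h1
    exact le_of_mul_le_mul_left h1 hq
  set z : ℂ := ⟨p 1, p 2⟩ with hz
  have hre := Complex.norm_mul_cos_arg z
  have him := Complex.norm_mul_sin_arg z
  simp only [hz] at hre him
  rw [← hz] at hre him
  obtain ⟨k, hk, hkφ⟩ := exists_parity_abs_sub_le hα z.arg k₀
  have hcos : Real.cos (Real.pi / n) ≤ Real.cos (z.arg - k * (Real.pi / n)) := by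
    rw [← Real.cos_abs (z.arg - k * (Real.pi / n))]
    exact Real.cos_le_cos_of_nonneg_of_le_pi (abs_nonneg _) hαpi hkφ
  have hr : ‖z‖ * (b * Real.cos (Real.pi / n)) ≤ a * (p 0 - t * |p 3|) := by
    have := hF k
    simp only [form, modelLateral, Matrix.cons_val] at this
    rw [← hre, ← him, paritySign_eq_of_even hk] at this
    have e : a * (p 0 - t * |p 3|) = a * p 0 - c * |p 3| := by rw [ht]; field_simp
    rw [Real.cos_sub] at hcos
    have := mul_le_mul_of_nonneg_left hcos (mul_nonneg (norm_nonneg z) hb.le)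
    rw [e, ← hk₀]
    nlinarith
  refine le_one_div_of_cone hκ0 hκ1 ht0 ht1 hp0 (abs_nonneg (p 3)) h3 (r := ‖z‖) ?_ ?_
  · have hz0 := norm_nonneg z
    have hsq := pow_le_pow_left₀ (by positivity) hr 2
    rw [hκ, div_mul_eq_mul_div, le_div_iff₀ (by positivity)]
    calc _ = (‖z‖ * (b * Real.cos (Real.pi / n))) ^ 2 := by ring
      _ ≤ _ := hsq
      _ = _ := by ring
  · rw [Complex.sq_norm, Complex.normSq_mk, sq_abs]
    simp only [form] at hp1
    linear_combination -hp1

theorem isCompact_model : IsCompact (polyhedron (model n a b c s q)) := by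
  obtain ⟨R, hR⟩ := h.exists_bound_model
  have hcont : ∀ u v : Minkowski → Minkowski, Continuous u → Continuous v →
      Continuous fun x => form (u x) (v x) := fun u v hu hv => by
    unfold form
    fun_prop
  have hset : polyhedron (model n a b c s q) =
      {x | form x x = -1} ∩ {x | 0 ≤ x 0} ∩ ⋂ f, {x | form x (model n a b c s q f) ≤ 0} := by
    ext x
    simp only [polyhedron, hyperbolicSpace, Set.mem_ofPred_eq, Set.mem_inter_iff, Set.mem_iInter]
    refine and_congr_left fun _ => and_congr_right fun hx => ⟨le_of_lt, fun h0 => ?_⟩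
    refine lt_of_le_of_ne h0 fun h0 => ?_
    simp only [form, ← h0] at hx
    nlinarith [sq_nonneg (x 1), sq_nonneg (x 2), sq_nonneg (x 3)]
  refine (isCompact_closedBall (0 : Minkowski) R).of_isClosed_subset ?_ fun x hx => ?_
  · rw [hset]
    refine ((isClosed_eq (hcont _ _ continuous_id continuous_id) continuous_const).inter
      (isClosed_le continuous_const (continuous_apply 0))).inter (isClosed_iInter fun f => ?_)
    exact isClosed_le (hcont _ _ continuous_id continuous_const) continuous_const
  · have hx0 := hx.1.2
    have hxR := hR x hx
    have hx1 := hx.1.1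
    simp only [form] at hx1
    rw [mem_closedBall_zero_iff]
    refine (pi_norm_le_iff_of_nonneg hx0.le).mpr (fun i => ?_) |>.trans hxR
    rw [Real.norm_eq_abs]
    refine abs_le_of_sq_le_sq ?_ hx0.le
    fin_cases i <;> simp only [Fin.zero_eta, Fin.mk_one, Fin.reduceFinMk] <;>
      nlinarith [sq_nonneg (x 1), sq_nonneg (x 2), sq_nonneg (x 3)]

theorem isLoebell_model : IsLoebell n (model n a b c s q) := by
  refine ⟨⟨h.model_self, h.isCompact_model, ⟨![1, 0, 0, 0], ?_, fun f => ?_⟩, ?_⟩,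
    h.hasLoebellType_model⟩
  · simp [hyperbolicSpace, form]
  · rcases face_cases_base f with ⟨j, rfl⟩ | ⟨k, rfl⟩
    · simpa [model_base, form, modelBase] using h.s_pos
    · simpa [model_lateral h.n_pos, form, modelLateral] using h.a_pos
  · rintro f g ⟨hfg, x, ⟨hxf, hxg⟩, -⟩
    obtain ⟨v, hv, hsub⟩ := h.exists_vertex_of_mem_model hxf.1.1
    rw [dihedralAngle, h.form_model_eq_zero hv (hsub f hxf) (hsub g hxg) hfg, neg_zero,
      Real.arccos_zero]

end IsCoefficients

end Loebell

end

theorem mainTheorem3 :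
    (∀ n : ℕ, 5 ≤ n → ∃ e : Loebell.LFace n → Loebell.Minkowski, Loebell.IsLoebell n e) ∧
    (∀ n : ℕ, 5 ≤ n → ∀ e : Loebell.LFace n → Loebell.Minkowski, Loebell.IsLoebell n e →
      Real.cosh (Loebell.topBottomDist e) =
        Real.cos (Real.pi / n) / Real.cos (2 * Real.pi / n)) ∧
    (∀ L : (n : ℕ) → Loebell.LFace n → Loebell.Minkowski,
      (∀ n : ℕ, 5 ≤ n → Loebell.IsLoebell n (L n)) →
      Tendsto (fun n : ℕ => Loebell.topBottomDist (L n)) atTop (𝓝 0)) := by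
  refine ⟨fun n hn => ?_, fun n hn e he => he.cosh_topBottomDist hn, fun L hL =>
    Loebell.tendsto_topBottomDist hL⟩
  obtain ⟨a, b, c, s, q, h⟩ := Loebell.exists_isCoefficients hn
  exact ⟨_, h.isLoebell_model⟩
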